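/- Let $U_1,U_2,U_3$ be independent random variables, uniformly distributed on $[0,1]$, and break the unit stick $[0,1]$ at these three points into $4$ pieces. Say that the pieces form a quadrilateral if there is a simple (non-self-intersecting, four distinct vertices) quadrilateral in the Euclidean plane whose side lengths, in some order, are the lengths of the $4$ pieces. This event $F$ has positive probability. Whenever it occurs, there is a quadrilateral of maximal area among all simple quadrilaterals with these side lengths, and every such quadrilateral of maximal area is cyclic (its vertices lie on a circle). Let $A$ be this maximal area. Then $A$ is integrable conditionally on $F$, and its conditional expectation is $$\mathbb E[A\mid F]=\frac{17\pi}{525}-\frac{\pi^2}{160}.$$ -/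

import Mathlib

open MeasureTheory ProbabilityTheory

noncomputable section

namespace BrokenStick

/-- The Euclidean plane. -/
abbrev Plane : Type := EuclideanSpace ℝ (Fin 2)

/-- A polygon is simple if its vertices are distinct and two different edges meet
only in common endpoints. -/
def IsSimple {n : ℕ} (Q : Polygon Plane n) : Prop :=
  Function.Injective Q.vertices ∧
    ∀ i j : Fin n, i ≠ j →
      Q.edgeSet ℝ i ∩ Q.edgeSet ℝ j ⊆
        ({Q i, Q (finRotate n i)} ∩ {Q j, Q (finRotate n j)} : Set Plane)

/-- The region enclosed by a polygon: the union of the bounded connected components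
of the complement of its boundary. -/
def enclosedRegion {n : ℕ} (Q : Polygon Plane n) : Set Plane :=
  {p | p ∉ Q.boundary ℝ ∧
    Bornology.IsBounded (connectedComponentIn (Q.boundary ℝ)ᶜ p)}

/-- The area of a polygon: the Lebesgue measure of the region it encloses. -/
def area {n : ℕ} (Q : Polygon Plane n) : ℝ :=
  (volume : Measure Plane).real (enclosedRegion Q)

/-- `Q` is a simple `n`-gon whose sides, taken in some order, have the lengths `l`. -/
def IsFormedFrom {n : ℕ} (l : Fin n → ℝ) (Q : Polygon Plane n) : Prop :=
  IsSimple Q ∧ ∃ σ : Equiv.Perm (Fin n), ∀ i, dist (Q i) (Q (finRotate n i)) = l (σ i)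

/-- `Q` has the largest area among all simple `n`-gons with side lengths `l`. -/
def IsMaximalFrom {n : ℕ} (l : Fin n → ℝ) (Q : Polygon Plane n) : Prop :=
  IsFormedFrom l Q ∧ ∀ R : Polygon Plane n, IsFormedFrom l R → area R ≤ area Q

/-- The largest area of a simple `n`-gon with side lengths `l`. -/
def maxArea {n : ℕ} (l : Fin n → ℝ) : ℝ :=
  sSup {a | ∃ Q : Polygon Plane n, IsFormedFrom l Q ∧ area Q = a}

/-- A polygon is cyclic if its vertices lie on a circle. -/
def IsCyclic {n : ℕ} (Q : Polygon Plane n) : Prop :=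
  EuclideanGeometry.Cospherical (Set.range Q.vertices)

/-- The lengths, from left to right, of the four pieces into which the break points
`u 0`, `u 1`, `u 2` (in any order) cut the stick `[0, 1]`. -/
def pieces (u : Fin 3 → ℝ) : Fin 4 → ℝ :=
  let v : Fin 3 → ℝ := u ∘ Tuple.sort u
  ![v 0, v 1 - v 0, v 2 - v 1, 1 - v 2]

/-- The four pieces form a quadrilateral. -/
def FormQuadrilateral (u : Fin 3 → ℝ) : Prop :=
  ∃ Q : Polygon Plane 4, IsFormedFrom (pieces u) Q

end BrokenStick

end

/-! Geometry. For a quadrilateral with sides x, y, z, w, Bretschneider's formula says that the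
squared shoelace area falls short of Brahmagupta's product by a multiple of |ζ| - Re ζ, where ζ =
(a-b)(c-d) conj((b-c)(a-d)) and |ζ| = xyzw. Hence the shoelace area is at most √∏(s - l i), with s
the half perimeter. Equality forces Im ζ = 0, so the vertices are concyclic. For a simple
quadrilateral the enclosed region has at most the shoelace area (`volume_inside_le`), and for a
strictly convex one at least that area (`PosConvex.le_volume_inside`). Whenever every side is
positive and shorter than the other three together, `exists_posConvex` constructs a strictly convex
quadrilateral attaining the bound. So these inequalities characterise the event F, and the maximal
area is Brahmagupta's expression.

Probability. The pieces sum to 1, so F says that all pieces lie in (0, 1/2), and there A = ∏ √(1/2 -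
l i). The numbers 1/2 - l i again sum to 1 and lie in (0, 1/2). Thus both P(F) and E[A; F] are 3!
times the integral of a product density ∏ g(x i), with g = 1 or g = √, over the part of the simplex
where all coordinates are below 1/2. At most one coordinate can reach 1/2, so this is the full
simplex integral minus four equal caps (`simplexIntegral_truncate`). Iterated convolution reduces
each term to one variable. The values are 1/12 for g = 1 and (17π/525 - π²/160)/12 for g = √, and
their quotient is the expectation. -/

noncomputable section

namespace BrokenStick

open Set
open scoped ENNReal

/-! ### Signed areas and the measure of triangles -/

/-- Twice the signed area of the triangle `a b p`. -/
def cross (a b p : Plane) : ℝ :=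
  (b 0 - a 0) * (p 1 - a 1) - (b 1 - a 1) * (p 0 - a 0)

lemma continuous_cross (a b : Plane) : Continuous (cross a b) := by
  unfold cross
  fun_prop

lemma cross_combo (a b p q : Plane) {s t : ℝ} (h : s + t = 1) :
    cross a b (s • p + t • q) = s * cross a b p + t * cross a b q := by
  obtain rfl : s = 1 - t := by linarith
  simp only [cross, PiLp.add_apply, PiLp.smul_apply, smul_eq_mul]
  ring

/-- The closed and the open standard triangle have area `1 / 2`. -/
lemma volume_standard_triangle :
    volume {x : Fin 2 → ℝ | 0 ≤ x 0 ∧ 0 ≤ x 1 ∧ x 0 + x 1 ≤ 1} = ENNReal.ofReal (1 / 2) ∧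
    volume {x : Fin 2 → ℝ | 0 < x 0 ∧ 0 < x 1 ∧ x 0 + x 1 < 1} = ENNReal.ofReal (1 / 2) := by
  have key : ∫⁻ x in Ioc (0 : ℝ) 1, ENNReal.ofReal (1 - x) = ENNReal.ofReal (1 / 2) := by
    rw [← ofReal_integral_eq_lintegral_ofReal, ← intervalIntegral.integral_of_le zero_le_one]
    · congr 1
      rw [intervalIntegral.integral_sub (by simp) (by simp)]
      norm_num
    · exact (Continuous.integrableOn_Icc (by fun_prop)).mono_set Ioc_subset_Icc_self
    · exact (ae_restrict_mem measurableSet_Ioc).mono fun x hx => sub_nonneg.2 hx.2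
  have hmp := (volume_preserving_finTwoArrow ℝ).symm
  -- At `x = 0` the slice of the closed triangle has length 1, but `0` is not in `Ioc 0 1`; this
  -- null set is discarded.
  have h0 : ∀ᵐ x : ℝ, x ≠ 0 := by simp [ae_iff]
  constructor
  · have hm : MeasurableSet {x : Fin 2 → ℝ | 0 ≤ x 0 ∧ 0 ≤ x 1 ∧ x 0 + x 1 ≤ 1} := by
      simp only [ofPred_and]
      refine .inter ?_ (.inter ?_ ?_) <;> refine measurableSet_le ?_ ?_ <;> fun_prop
    rw [← hmp.measure_preimage hm.nullMeasurableSet, Measure.volume_eq_prod,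
      Measure.prod_apply (hm.preimage hmp.measurable), ← key, ← lintegral_indicator measurableSet_Ioc]
    refine lintegral_congr_ae (h0.mono fun x hx => ?_)
    simp only [preimage_ofPred_eq, MeasurableEquiv.finTwoArrow_symm_apply]
    by_cases h : x ∈ Ioc (0 : ℝ) 1
    · rw [indicator_of_mem h, ← sub_zero (1 - x), ← Real.volume_Icc]
      congr 1
      ext t
      simp only [mem_ofPred_eq, mem_Icc]
      simp
      constructor
      · intro h'; exact ⟨h'.2.1, by linarith [h'.2.2]⟩
      · intro h'; exact ⟨h.1.le, h'.1, by linarith [h'.2]⟩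
    · rw [indicator_of_notMem h]
      convert measure_empty (μ := (volume : Measure ℝ))
      ext t
      simp
      intro h1 h2
      by_contra! h3
      exact h ⟨lt_of_le_of_ne h1 (Ne.symm hx), by linarith⟩
  · have hm : MeasurableSet {x : Fin 2 → ℝ | 0 < x 0 ∧ 0 < x 1 ∧ x 0 + x 1 < 1} := by
      simp only [ofPred_and]
      refine .inter ?_ (.inter ?_ ?_) <;> refine measurableSet_lt ?_ ?_ <;> fun_prop
    rw [← hmp.measure_preimage hm.nullMeasurableSet, Measure.volume_eq_prod,
      Measure.prod_apply (hm.preimage hmp.measurable), ← key, ← lintegral_indicator measurableSet_Ioc]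
    refine lintegral_congr_ae (h0.mono fun x hx => ?_)
    simp only [preimage_ofPred_eq, MeasurableEquiv.finTwoArrow_symm_apply]
    by_cases h : x ∈ Ioc (0 : ℝ) 1
    · rw [indicator_of_mem h, ← sub_zero (1 - x), ← Real.volume_Ioo]
      congr 1
      ext t
      simp only [mem_ofPred_eq, mem_Ioo]
      simp
      constructor
      · intro h'; exact ⟨h'.2.1, by linarith [h'.2.2]⟩
      · intro h'; exact ⟨h.1, h'.1, by linarith [h'.2]⟩
    · rw [indicator_of_notMem h]
      convert measure_empty (μ := (volume : Measure ℝ))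
      ext t
      simp
      intro h1 h2
      by_contra! h3
      exact h ⟨h1, by linarith⟩

/-- The closed triangle `a b c` (for positively oriented vertices). -/
def closedTriangle (a b c : Plane) : Set Plane :=
  {p | 0 ≤ cross a b p ∧ 0 ≤ cross b c p ∧ 0 ≤ cross c a p}

/-- The open triangle `a b c` (for positively oriented vertices). -/
def openTriangle (a b c : Plane) : Set Plane :=
  {p | 0 < cross a b p ∧ 0 < cross b c p ∧ 0 < cross c a p}

lemma isClosed_closedTriangle (a b c : Plane) : IsClosed (closedTriangle a b c) := by
  refine .inter ?_ (.inter ?_ ?_) <;>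
    exact isClosed_le continuous_const (continuous_cross _ _)

lemma isOpen_openTriangle (a b c : Plane) : IsOpen (openTriangle a b c) := by
  refine .inter ?_ (.inter ?_ ?_) <;>
    exact isOpen_lt continuous_const (continuous_cross _ _)

/-- The affine map sending the standard frame to `a, b, c` has determinant `cross a b c`, so areas
can be computed in the coordinates of that frame. -/
lemma volume_eq_of_affine_preimage (a b c : Plane) (h : 0 < cross a b c) {T : Set Plane}
    (hT : MeasurableSet T) {S : Set (Fin 2 → ℝ)}
    (hS : ∀ x : Fin 2 → ℝ, x ∈ S ↔ a + x 0 • (b - a) + x 1 • (c - a) ∈ T) :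
    volume T = ENNReal.ofReal (cross a b c) * volume S := by
  set M : Matrix (Fin 2) (Fin 2) ℝ := !![b 0 - a 0, c 0 - a 0; b 1 - a 1, c 1 - a 1] with hM
  have hdet : M.det = cross a b c := by
    rw [hM, Matrix.det_fin_two_of, cross]
    ring
  have hmap := Real.map_matrix_volume_pi_eq_smul_volume_pi (M := M) (by rw [hdet]; exact h.ne')
  set T' : Set (Fin 2 → ℝ) := {x | a + WithLp.toLp 2 x ∈ T} with hT'
  have hT'm : MeasurableSet T' := by
    have : Measurable fun x : Fin 2 → ℝ => a + (WithLp.toLp 2 x : Plane) := by fun_prop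
    exact this hT
  have h1 : volume T' = volume T := by
    have e : T' = (WithLp.toLp 2) ⁻¹' ((fun p : Plane => a + p) ⁻¹' T) := rfl
    rw [e, (PiLp.volume_preserving_toLp (Fin 2)).measure_preimage
      ((measurable_const_add a) hT).nullMeasurableSet, measure_preimage_add]
  have h2 : (Matrix.toLin' M) ⁻¹' T' = S := by
    ext x
    rw [hS]
    simp only [hT', mem_preimage, mem_ofPred_eq]
    have : a + WithLp.toLp 2 (Matrix.toLin' M x) = a + x 0 • (b - a) + x 1 • (c - a) := by
      ext i
      fin_cases i <;> simp [hM, dotProduct, Fin.sum_univ_two] <;> ring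
    rw [this]
  have h3 := congrArg (fun μ => μ T') hmap
  simp only [Measure.smul_apply, smul_eq_mul] at h3
  rw [Measure.map_apply (LinearMap.continuous_of_finiteDimensional _).measurable hT'm, h2, h1, hdet]
    at h3
  rw [h3, ← mul_assoc, ← ENNReal.ofReal_mul h.le, abs_of_pos (inv_pos.2 h),
    mul_inv_cancel₀ h.ne', ENNReal.ofReal_one, one_mul]

lemma cross_affine (a b c : Plane) (s t : ℝ) :
    cross a b (a + s • (b - a) + t • (c - a)) = t * cross a b c ∧
    cross b c (a + s • (b - a) + t • (c - a)) = (1 - s - t) * cross a b c ∧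
    cross c a (a + s • (b - a) + t • (c - a)) = s * cross a b c := by
  simp only [cross, PiLp.add_apply, PiLp.smul_apply, PiLp.sub_apply, smul_eq_mul]
  refine ⟨?_, ?_, ?_⟩ <;> ring

lemma volume_closedTriangle {a b c : Plane} (h : 0 < cross a b c) :
    volume (closedTriangle a b c) = ENNReal.ofReal (cross a b c / 2) := by
  rw [volume_eq_of_affine_preimage a b c h (isClosed_closedTriangle a b c).measurableSet,
    volume_standard_triangle.1, ← ENNReal.ofReal_mul h.le, mul_one_div]
  intro x
  obtain ⟨h1, h2, h3⟩ := cross_affine a b c (x 0) (x 1)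
  simp only [closedTriangle, mem_ofPred_eq, h1, h2, h3, mul_nonneg_iff_of_pos_right h]
  constructor
  · rintro ⟨h1, h2, h3⟩; exact ⟨h2, by linarith, h1⟩
  · rintro ⟨h1, h2, h3⟩; exact ⟨h3, h1, by linarith⟩

lemma volume_openTriangle {a b c : Plane} (h : 0 < cross a b c) :
    volume (openTriangle a b c) = ENNReal.ofReal (cross a b c / 2) := by
  rw [volume_eq_of_affine_preimage a b c h (isOpen_openTriangle a b c).measurableSet,
    volume_standard_triangle.2, ← ENNReal.ofReal_mul h.le, mul_one_div]
  intro x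
  obtain ⟨h1, h2, h3⟩ := cross_affine a b c (x 0) (x 1)
  simp only [openTriangle, mem_ofPred_eq, h1, h2, h3, mul_pos_iff_of_pos_right h]
  constructor
  · rintro ⟨h1, h2, h3⟩; exact ⟨h2, by linarith, h1⟩
  · rintro ⟨h1, h2, h3⟩; exact ⟨h3, h1, by linarith⟩

/-- The line through two distinct points is a null set. -/
lemma volume_line {a b : Plane} (h : a ≠ b) : volume {p : Plane | cross a b p = 0} = 0 := by
  -- `c - a` is `b - a` turned by a right angle, so `cross a b c` is the squared length of `b - a`.
  set c : Plane := !₂[a 0 - (b 1 - a 1), a 1 + (b 0 - a 0)] with hc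
  have hpos : 0 < cross a b c := by
    have e : cross a b c = (b 0 - a 0) ^ 2 + (b 1 - a 1) ^ 2 := by
      simp only [cross, hc, PiLp.toLp_apply, Matrix.cons_val_zero, Matrix.cons_val_one]
      ring
    rw [e]
    by_contra! hle
    refine h ?_
    ext i
    fin_cases i <;> simp <;> nlinarith [sq_nonneg (b 0 - a 0), sq_nonneg (b 1 - a 1)]
  rw [volume_eq_of_affine_preimage a b c hpos (S := {x | x 1 = 0})
    (isClosed_eq (continuous_cross a b) continuous_const).measurableSet]
  · rw [show volume {x : Fin 2 → ℝ | x 1 = 0} = 0 from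
      Measure.pi_hyperplane (fun _ : Fin 2 => (volume : Measure ℝ)) 1 0, mul_zero]
  · intro x
    simp only [mem_ofPred_eq, (cross_affine a b c (x 0) (x 1)).1, mul_eq_zero, hpos.ne', or_false]

/-! ### Upper bound for the region enclosed by a closed path of four segments -/

/-- The closed polygonal path `a b c d a`. -/
def fourSegments (a b c d : Plane) : Set Plane :=
  segment ℝ a b ∪ segment ℝ b c ∪ segment ℝ c d ∪ segment ℝ d a

/-- The union of the bounded components of the complement of `S`. -/
def inside (S : Set Plane) : Set Plane :=
  {p | p ∉ S ∧ Bornology.IsBounded (connectedComponentIn Sᶜ p)}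

lemma fourSegments_rotate (a b c d : Plane) : fourSegments b c d a = fourSegments a b c d := by
  unfold fourSegments
  ac_rfl

lemma fourSegments_reverse (a b c d : Plane) : fourSegments a d c b = fourSegments a b c d := by
  simp only [fourSegments, segment_symm ℝ a d, segment_symm ℝ d c, segment_symm ℝ c b,
    segment_symm ℝ b a]
  ac_rfl

/-- A convex set missing `S` lies in a single component of the complement, and a ray in it makes
that component unbounded. Every upper bound on the enclosed region rests on this escape argument. -/
lemma notMem_inside_of_convex {S T : Set Plane} (hT : Convex ℝ T) (hd : Disjoint T S)
    {p v : Plane} (hp : p ∈ T) (hv : v ≠ 0) (hray : ∀ t : ℝ, 0 ≤ t → p + t • v ∈ T) :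
    p ∉ inside S := by
  rintro ⟨-, hb⟩
  have hsub : T ⊆ connectedComponentIn Sᶜ p :=
    hT.isPreconnected.subset_connectedComponentIn hp hd.subset_compl_right
  obtain ⟨R, hR⟩ := (hb.subset hsub).exists_norm_le
  have hR0 : 0 ≤ R := (norm_nonneg p).trans (hR p hp)
  have hv' : 0 < ‖v‖ := norm_pos_iff.2 hv
  -- Chosen so that `t • v` has norm `2 * R + 1`, more than two vectors of norm at most `R` allow.
  set t := (2 * R + 1) / ‖v‖ with ht
  have ht0 : 0 ≤ t := by positivity
  have h1 := hR _ (hray t ht0)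
  have h2 : ‖t • v‖ = 2 * R + 1 := by
    rw [norm_smul, Real.norm_of_nonneg ht0, ht, div_mul_cancel₀ _ hv'.ne']
  have h3 : ‖t • v‖ ≤ ‖p + t • v‖ + ‖p‖ := by
    simpa using norm_sub_le (p + t • v) p
  linarith [hR p hp]

lemma convex_cross_nonneg (a b : Plane) : Convex ℝ {p | 0 ≤ cross a b p} := by
  intro p hp q hq s t hs ht hst
  simp only [mem_ofPred_eq] at *
  rw [cross_combo a b p q hst]
  positivity

lemma convex_cross_neg (a b : Plane) : Convex ℝ {p | cross a b p < 0} := by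
  intro p hp q hq s t hs ht hst
  simp only [mem_ofPred_eq] at *
  rw [cross_combo a b p q hst]
  rcases hs.eq_or_lt with rfl | hs
  · nlinarith
  · nlinarith

lemma cross_nonneg_of_mem_segment {u v a b p : Plane} (ha : 0 ≤ cross u v a)
    (hb : 0 ≤ cross u v b) (hp : p ∈ segment ℝ a b) : 0 ≤ cross u v p :=
  (convex_cross_nonneg u v).segment_subset ha hb hp

lemma cross_self_left (a b : Plane) : cross a b a = 0 := by simp [cross]

lemma cross_self_right (a b : Plane) : cross a b b = 0 := by
  simp only [cross]; ring

lemma cross_rotate (a b c : Plane) : cross b c a = cross a b c := by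
  simp only [cross]; ring

lemma cross_swap (a b c : Plane) : cross b a c = -cross a b c := by
  simp only [cross]; ring

/-- Cutting along either diagonal gives the same shoelace area. -/
lemma cross_add_cross (a b c d : Plane) :
    cross b c d + cross d a b = cross c d a + cross a b c := by
  simp only [cross]; ring

lemma ne_of_cross_ne_zero {a b p : Plane} (h : cross a b p ≠ 0) : a ≠ b := by
  rintro rfl
  simp [cross] at h

/-- A point strictly beyond the line `u v` escapes parallel to that line, through an open half-plane
that the path does not enter. -/
lemma inside_subset_halfPlane {a b c d u v : Plane} (ha : 0 ≤ cross u v a) (hb : 0 ≤ cross u v b)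
    (hc : 0 ≤ cross u v c) (hd : 0 ≤ cross u v d) :
    inside (fourSegments a b c d) ⊆ {p | 0 ≤ cross u v p} := by
  intro p hp
  simp only [mem_ofPred_eq]
  by_contra! hneg
  have huv := ne_of_cross_ne_zero hneg.ne
  refine notMem_inside_of_convex (convex_cross_neg u v) ?_ hneg (sub_ne_zero.2 huv.symm) ?_ hp
  · rw [disjoint_left]
    intro q hq hq'
    refine not_le.2 (show cross u v q < 0 from hq) ?_
    rcases hq' with ((h | h) | h) | h
    exacts [cross_nonneg_of_mem_segment ha hb h, cross_nonneg_of_mem_segment hb hc h,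
      cross_nonneg_of_mem_segment hc hd h, cross_nonneg_of_mem_segment hd ha h]
  · intro t _
    have e : cross u v (p + t • (v - u)) = cross u v p := by
      simp only [cross, PiLp.add_apply, PiLp.smul_apply, PiLp.sub_apply, smul_eq_mul]
      ring
    simpa only [mem_ofPred_eq, e] using hneg

/-- The open cone with apex `c` to the right of both `b c` and `c d` misses the path: the first two
edges stay left of `b c`, the last two left of `c d`. A point of the cone escapes along the ray
pointing away from `c`. This replaces the half-plane bounds at a reflex vertex `c`. -/
lemma inside_subset_compl_cone {a b c d : Plane} (hd : 0 ≤ cross a b c) (hb : 0 ≤ cross c d a) :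
    inside (fourSegments a b c d) ⊆ {p | 0 ≤ cross b c p ∨ 0 ≤ cross c d p} := by
  intro p hp
  simp only [mem_ofPred_eq]
  by_contra! hneg
  have hpc : p ≠ c := by
    rintro rfl
    simp [cross_self_right] at hneg
  refine notMem_inside_of_convex ((convex_cross_neg b c).inter (convex_cross_neg c d)) ?_ hneg
    (sub_ne_zero.2 hpc) ?_ hp
  · rw [disjoint_left]
    rintro q ⟨hq1, hq2⟩ hq'
    simp only [mem_ofPred_eq] at hq1 hq2
    have h1 : 0 ≤ cross b c a := by rwa [cross_rotate]
    have h2 : 0 ≤ cross c d a := hb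
    rcases hq' with ((h | h) | h) | h
    · exact hq1.not_ge (cross_nonneg_of_mem_segment h1 (cross_self_left b c).ge h)
    · exact hq1.not_ge (cross_nonneg_of_mem_segment (cross_self_left b c).ge
        (cross_self_right b c).ge h)
    · exact hq2.not_ge (cross_nonneg_of_mem_segment (cross_self_left c d).ge
        (cross_self_right c d).ge h)
    · exact hq2.not_ge (cross_nonneg_of_mem_segment (cross_self_right c d).ge h2 h)
  · intro t ht
    have e1 : cross b c (p + t • (p - c)) = (1 + t) * cross b c p := by
      simp only [cross, PiLp.add_apply, PiLp.smul_apply, PiLp.sub_apply, smul_eq_mul]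
      ring
    have e2 : cross c d (p + t • (p - c)) = (1 + t) * cross c d p := by
      simp only [cross, PiLp.add_apply, PiLp.smul_apply, PiLp.sub_apply, smul_eq_mul]
      ring
    simp only [mem_inter_iff, mem_ofPred_eq, e1, e2]
    constructor <;> nlinarith

lemma inside_subset_of_convex {a b c d : Plane} (hδ : 0 < cross a b c) (hβ : 0 < cross c d a)
    (hα : 0 ≤ cross b c d) (hγ : 0 ≤ cross d a b) :
    inside (fourSegments a b c d) ⊆ closedTriangle a b c ∪ closedTriangle c d a := by
  intro p hp
  have z1 := (cross_self_left a b).ge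
  have z2 := (cross_self_right a b).ge
  have z3 := (cross_self_left b c).ge
  have z4 := (cross_self_right b c).ge
  have z5 := (cross_self_left c d).ge
  have z6 := (cross_self_right c d).ge
  have z7 := (cross_self_left d a).ge
  have z8 := (cross_self_right d a).ge
  have r1 : 0 ≤ cross a b d := by rwa [← cross_rotate, ← cross_rotate]
  have r2 : 0 ≤ cross b c a := by rw [cross_rotate]; exact hδ.le
  have r3 : 0 ≤ cross c d b := by rwa [cross_rotate]
  have r4 : 0 ≤ cross d a c := by rw [cross_rotate]; exact hβ.le
  have f1 := inside_subset_halfPlane z1 z2 hδ.le r1 hp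
  have f2 := inside_subset_halfPlane r2 z3 z4 hα hp
  have f3 := inside_subset_halfPlane hβ.le r3 z5 z6 hp
  have f4 := inside_subset_halfPlane z8 hγ r4 z7 hp
  rcases le_total 0 (cross a c p) with h | h
  · exact Or.inr ⟨f3, f4, h⟩
  · exact Or.inl ⟨f1, f2, by rw [cross_swap]; linarith⟩

lemma inside_subset_of_reflex {a b c d : Plane} (hδ : 0 < cross a b c) (hβ : 0 < cross c d a)
    (hα : cross b c d < 0) :
    inside (fourSegments a b c d) ⊆ closedTriangle a b c ∪ closedTriangle c d a := by
  intro p hp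
  have hγ : 0 < cross d a b := by linarith [cross_add_cross a b c d]
  have r1 : 0 ≤ cross a b d := by rw [← cross_rotate, ← cross_rotate]; exact hγ.le
  have r4 : 0 ≤ cross d a c := by rw [cross_rotate]; exact hβ.le
  have f1 : 0 ≤ cross a b p := inside_subset_halfPlane (cross_self_left a b).ge
    (cross_self_right a b).ge hδ.le r1 hp
  have f4 : 0 ≤ cross d a p := inside_subset_halfPlane (cross_self_right d a).ge hγ.le r4
    (cross_self_left d a).ge hp
  have f23 : 0 ≤ cross b c p ∨ 0 ≤ cross c d p := inside_subset_compl_cone hδ.le hβ.le hp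
  -- The three affine functions of `p` all vanish at `c`, hence are linearly dependent. The signs of
  -- the coefficients turn the disjunction `f23` into the inequality needed on each side of the
  -- diagonal.
  have key : cross b c d * cross a c p - cross c d a * cross b c p + cross a b c * cross c d p
      = 0 := by
    simp only [cross]; ring
  rcases le_total 0 (cross a c p) with h | h
  · refine Or.inr ⟨?_, f4, h⟩
    rcases f23 with f | f
    · by_contra! hn
      nlinarith [mul_nonneg hβ.le f, mul_pos_of_neg_of_neg hα (neg_neg_of_pos hδ)]
    · exact f
  · refine Or.inl ⟨f1, ?_, by rw [cross_swap]; linarith⟩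
    rcases f23 with f | f
    · exact f
    · by_contra! hn
      nlinarith [mul_nonneg hδ.le f, mul_nonneg_of_nonpos_of_nonpos hα.le h,
        mul_pos_of_neg_of_neg hn (neg_neg_of_pos hβ)]

/-- With `b` and `d` on opposite sides of `a c`, a reflex vertex can only be `a` or `c`; a half turn
of the labels exchanges these cases. -/
lemma inside_subset_triangles {a b c d : Plane} (hδ : 0 < cross a b c) (hβ : 0 < cross c d a) :
    inside (fourSegments a b c d) ⊆ closedTriangle a b c ∪ closedTriangle c d a := by
  rcases lt_or_ge (cross b c d) 0 with hα | hα
  · exact inside_subset_of_reflex hδ hβ hα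
  rcases lt_or_ge (cross d a b) 0 with hγ | hγ
  · have := inside_subset_of_reflex hβ hδ hγ
    rwa [fourSegments_rotate, fourSegments_rotate, union_comm] at this
  · exact inside_subset_of_convex hδ hβ hα hγ

lemma volume_inside_le_of_pos {a b c d : Plane} (hδ : 0 < cross a b c) (hβ : 0 < cross c d a) :
    volume (inside (fourSegments a b c d)) ≤
      ENNReal.ofReal ((cross a b c + cross c d a) / 2) := by
  refine (measure_mono (inside_subset_triangles hδ hβ)).trans ((measure_union_le _ _).trans ?_)
  rw [volume_closedTriangle hδ, volume_closedTriangle hβ,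
    ← ENNReal.ofReal_add (by positivity) (by positivity), add_div]

lemma volume_inside_le_of_mul_pos {a b c d : Plane} (h : 0 < cross a b c * cross c d a) :
    volume (inside (fourSegments a b c d)) ≤
      ENNReal.ofReal (|cross a b c + cross c d a| / 2) := by
  rcases mul_pos_iff.1 h with ⟨hδ, hβ⟩ | ⟨hδ, hβ⟩
  · rw [abs_of_pos (by positivity)]
    exact volume_inside_le_of_pos hδ hβ
  · have e1 : cross a d c = -cross c d a := by simp only [cross]; ring
    have e2 : cross c b a = -cross a b c := by simp only [cross]; ring
    have := volume_inside_le_of_pos (a := a) (b := d) (c := c) (d := b) (by linarith) (by linarith)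
    rw [fourSegments_reverse, e1, e2] at this
    rw [abs_of_neg (by linarith)]
    convert this using 2
    ring

/-- If neither diagonal leaves the two other vertices strictly on different sides, then two
opposite sides meet, or the four points are collinear. -/
lemma opposite_segments_meet_or_collinear {a b c d : Plane}
    (h1 : cross a b c * cross c d a ≤ 0) (h2 : cross b c d * cross d a b ≤ 0) :
    (segment ℝ a b ∩ segment ℝ c d).Nonempty ∨ (segment ℝ b c ∩ segment ℝ d a).Nonempty ∨
      cross a b c = 0 ∧ cross c d a = 0 := by
  have hsum := cross_add_cross a b c d
  -- The affine dependence of four points in the plane. Moving the terms with negative coefficients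
  -- across produces a common point of two opposite sides; the sign pattern decides which pair.
  have hrel : ∀ i, cross b c d * a i + cross d a b * c i = cross c d a * b i + cross a b c * d i := by
    intro i
    fin_cases i <;> simp only [cross, Fin.zero_eta, Fin.mk_one, Fin.isValue] <;> ring
  by_cases hz : cross a b c = 0 ∧ cross c d a = 0
  · exact Or.inr (Or.inr hz)
  have meet : ∀ (p q r s : Plane) (x y z w : ℝ), 0 ≤ x → 0 ≤ y → 0 ≤ z → 0 ≤ w → 0 < x + y →
      x + y = z + w → (∀ i, x * p i + y * q i = z * r i + w * s i) →
      (segment ℝ p q ∩ segment ℝ r s).Nonempty := by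
    intro p q r s x y z w hx hy hz hw hpos he hi
    refine ⟨(x / (x + y)) • p + (y / (x + y)) • q, ⟨_, _, by positivity, by positivity, by
      field_simp, rfl⟩, ⟨z / (x + y), w / (x + y), by positivity, by positivity, by
      rw [← add_div, ← he, div_self hpos.ne'], ?_⟩⟩
    ext i
    simp only [PiLp.add_apply, PiLp.smul_apply, smul_eq_mul]
    have := hi i
    field_simp
    linarith
  have hz' : ∀ x y : ℝ, 0 ≤ x → 0 ≤ y → (x + y = 0 → cross a b c = 0 ∧ cross c d a = 0) →
      0 < x + y := fun x y hx hy h => lt_of_le_of_ne (by positivity) fun h' => hz (h h'.symm)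
  rcases mul_nonpos_iff.1 h1 with ⟨hδ, hβ⟩ | ⟨hδ, hβ⟩ <;>
    rcases mul_nonpos_iff.1 h2 with ⟨hα, hγ⟩ | ⟨hα, hγ⟩
  · refine Or.inl (meet a b c d (cross b c d) (-cross c d a) (-cross d a b) (cross a b c) hα
      (by linarith) (by linarith) hδ (hz' _ _ hα (by linarith) fun h => ?_) (by linarith)
      fun i => by linarith [hrel i])
    constructor <;> linarith
  · refine Or.inr (Or.inl ?_)
    rw [inter_comm]
    refine meet d a b c (cross a b c) (-cross b c d) (-cross c d a) (cross d a b) hδ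
      (by linarith) (by linarith) hγ (hz' _ _ hδ (by linarith) fun h => ?_) (by linarith)
      fun i => by linarith [hrel i]
    constructor <;> linarith
  · refine Or.inr (Or.inl (meet b c d a (cross c d a) (-cross d a b) (-cross a b c) (cross b c d)
      hβ (by linarith) (by linarith) hα (hz' _ _ hβ (by linarith) fun h => ?_) (by linarith)
      fun i => by linarith [hrel i]))
    constructor <;> linarith
  · refine Or.inl ?_
    rw [inter_comm]
    refine meet c d a b (cross d a b) (-cross a b c) (-cross b c d) (cross c d a) hγ
      (by linarith) (by linarith) hβ (hz' _ _ hγ (by linarith) fun h => ?_) (by linarith)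
      fun i => by linarith [hrel i]
    constructor <;> linarith

lemma volume_inside_eq_zero_of_collinear {a b c d : Plane} (hac : a ≠ c) (hδ : cross a b c = 0)
    (hβ : cross c d a = 0) : volume (inside (fourSegments a b c d)) = 0 := by
  have hb : cross a c b = 0 := by
    rw [cross_swap c a b, cross_rotate, cross_rotate, hδ, neg_zero]
  have hd : cross a c d = 0 := by rwa [← cross_rotate]
  have hca : ∀ p, cross c a p = -cross a c p := cross_swap a c
  refine measure_mono_null (fun p hp => ?_) (volume_line hac)
  have h1 := inside_subset_halfPlane (cross_self_left a c).ge hb.ge (cross_self_right a c).ge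
    hd.ge hp
  have h2 := inside_subset_halfPlane (cross_self_right c a).ge (by rw [hca, hb, neg_zero])
    (cross_self_left c a).ge (by rw [hca, hd, neg_zero]) hp
  simp only [mem_ofPred_eq, hca] at h1 h2 ⊢
  linarith

/-- The region inside a quadrilateral whose opposite sides are disjoint is at most as large as the
shoelace formula says. -/
lemma volume_inside_le {a b c d : Plane} (hac : a ≠ c)
    (h1 : Disjoint (segment ℝ a b) (segment ℝ c d)) (h2 : Disjoint (segment ℝ b c) (segment ℝ d a)) :
    volume (inside (fourSegments a b c d)) ≤
      ENNReal.ofReal (|cross a b c + cross c d a| / 2) := by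
  rcases lt_or_ge 0 (cross a b c * cross c d a) with h | h
  · exact volume_inside_le_of_mul_pos h
  rcases lt_or_ge 0 (cross b c d * cross d a b) with h' | h'
  · have := volume_inside_le_of_mul_pos h'
    rwa [fourSegments_rotate, cross_add_cross, add_comm (cross c d a)] at this
  rcases opposite_segments_meet_or_collinear h h' with h | h | ⟨h, h'⟩
  · exact absurd h1 (not_disjoint_iff_nonempty_inter.2 h)
  · exact absurd h2 (not_disjoint_iff_nonempty_inter.2 h)
  · rw [volume_inside_eq_zero_of_collinear hac h h']
    exact zero_le

/-! ### Lower bound for the region enclosed by a strictly convex quadrilateral -/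

/-- The vertices `a b c d`, in this order, span a strictly convex, positively oriented
quadrilateral. -/
structure PosConvex (a b c d : Plane) : Prop where
  abc : 0 < cross a b c
  bcd : 0 < cross b c d
  cda : 0 < cross c d a
  dab : 0 < cross d a b

lemma PosConvex.rotate {a b c d : Plane} (h : PosConvex a b c d) : PosConvex b c d a :=
  ⟨h.bcd, h.cda, h.dab, h.abc⟩

lemma cross_eq_zero_of_mem_segment {a b p : Plane} (hp : p ∈ segment ℝ a b) : cross a b p = 0 := by
  obtain ⟨s, t, -, -, hst, rfl⟩ := hp
  rw [cross_combo _ _ _ _ hst, cross_self_left, cross_self_right, mul_zero, mul_zero, add_zero]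

lemma PosConvex.disjoint {a b c d : Plane} (h : PosConvex a b c d) :
    Disjoint (segment ℝ a b) (segment ℝ c d) := by
  rw [disjoint_left]
  rintro p hp ⟨s, t, hs, ht, hst, rfl⟩
  have h0 := cross_eq_zero_of_mem_segment hp
  have r1 : 0 < cross a b d := by rw [← cross_rotate, ← cross_rotate]; exact h.dab
  rw [cross_combo _ _ _ _ hst] at h0
  have h1 := mul_nonneg hs h.abc.le
  have h2 := mul_nonneg ht r1.le
  have hs0 : s = 0 := by
    rcases mul_eq_zero.1 (le_antisymm (by linarith) h1) with h | h'
    exacts [h, absurd h' h.abc.ne']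
  have ht0 : t = 0 := by
    rcases mul_eq_zero.1 (le_antisymm (by linarith) h2) with h | h'
    exacts [h, absurd h' r1.ne']
  linarith

lemma PosConvex.inter_subset {a b c d : Plane} (h : PosConvex a b c d) :
    segment ℝ a b ∩ segment ℝ b c ⊆ {b} := by
  rintro p ⟨hp, s, t, hs, ht, hst, rfl⟩
  have h0 := cross_eq_zero_of_mem_segment hp
  rw [cross_combo _ _ _ _ hst, cross_self_right, mul_zero, zero_add] at h0
  have ht0 : t = 0 := (mul_eq_zero.1 h0).resolve_right h.abc.ne'
  have hs1 : s = 1 := by linarith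
  simp [ht0, hs1]

/-- The region on the inner side of all four edges. -/
def innerRegion (a b c d : Plane) : Set Plane :=
  {p | 0 < cross a b p ∧ 0 < cross b c p ∧ 0 < cross c d p ∧ 0 < cross d a p}

/-- In a strictly convex quadrilateral, a point of the line `a b` on the inner side of the two
neighbouring edges lies on the edge `a b`. -/
lemma PosConvex.mem_segment {a b c d p : Plane} (h : PosConvex a b c d) (h0 : cross a b p = 0)
    (h1 : 0 ≤ cross b c p) (h2 : 0 ≤ cross d a p) : p ∈ segment ℝ a b := by
  have e : ∀ i, cross a b c * (p i - a i) = (cross a b c - cross b c p - cross a b p) * (b i - a i) +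
      cross a b p * (c i - a i) := by
    intro i
    fin_cases i <;> simp only [cross, Fin.zero_eta, Fin.mk_one, Fin.isValue] <;> ring
  have e2 : cross a b c * cross d a p = (cross a b c - cross b c p - cross a b p) * cross d a b
      + cross a b p * cross d a c := by
    simp only [cross]; ring
  have hle : cross b c p ≤ cross a b c := by
    rw [h0, zero_mul, add_zero, sub_zero] at e2
    have := mul_nonneg h.abc.le h2
    rw [e2] at this
    have := nonneg_of_mul_nonneg_left this h.dab
    linarith
  have hδ := h.abc
  refine ⟨cross b c p / cross a b c, (cross a b c - cross b c p) / cross a b c, by positivity,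
    div_nonneg (by linarith) hδ.le, by field_simp; ring, ?_⟩
  ext i
  simp only [PiLp.add_apply, PiLp.smul_apply, smul_eq_mul]
  have := e i
  rw [h0, sub_zero] at this
  field_simp
  linarith

lemma isBounded_closedTriangle {a b c : Plane} (h : 0 < cross a b c) :
    Bornology.IsBounded (closedTriangle a b c) := by
  have hK : IsCompact ((fun x : ℝ × ℝ => a + x.1 • (b - a) + x.2 • (c - a)) ''
      (Icc 0 1 ×ˢ Icc 0 1)) :=
    (isCompact_Icc.prod isCompact_Icc).image (by fun_prop)
  refine hK.isBounded.subset ?_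
  rintro p ⟨h1, h2, h3⟩
  have hsum : cross a b p + cross b c p + cross c a p = cross a b c := by
    simp only [cross]; ring
  refine ⟨(cross c a p / cross a b c, cross a b p / cross a b c),
    ⟨⟨by positivity, (div_le_one h).2 (by linarith)⟩,
      ⟨by positivity, (div_le_one h).2 (by linarith)⟩⟩, ?_⟩
  have e : ∀ i, cross a b c * (p i - a i) = cross c a p * (b i - a i) +
      cross a b p * (c i - a i) := by
    intro i
    fin_cases i <;> simp only [cross, Fin.zero_eta, Fin.mk_one, Fin.isValue] <;> ring
  ext i
  simp only [PiLp.add_apply, PiLp.smul_apply, PiLp.sub_apply, smul_eq_mul]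
  have := e i
  field_simp
  linarith

lemma PosConvex.isBounded_innerRegion {a b c d : Plane} (h : PosConvex a b c d) :
    Bornology.IsBounded (innerRegion a b c d) := by
  refine ((isBounded_closedTriangle h.abc).union (isBounded_closedTriangle h.cda)).subset ?_
  rintro p ⟨h1, h2, h3, h4⟩
  rcases le_total 0 (cross a c p) with h | h
  · exact Or.inr ⟨h3.le, h4.le, h⟩
  · exact Or.inl ⟨h1.le, h2.le, by rw [cross_swap]; linarith⟩

lemma isOpen_innerRegion (a b c d : Plane) : IsOpen (innerRegion a b c d) := by
  refine .inter ?_ (.inter ?_ (.inter ?_ ?_)) <;>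
    exact isOpen_lt continuous_const (continuous_cross _ _)

/-- A point of the closed quadrilateral `C` that is off the path lies in the open inner region. So
the complement of the path is covered by two disjoint open sets, the inner region and `Cᶜ`, and a
component meeting the bounded first one stays in it. -/
lemma PosConvex.innerRegion_subset_inside {a b c d : Plane} (h : PosConvex a b c d) :
    innerRegion a b c d ⊆ inside (fourSegments a b c d) := by
  set C : Set Plane := {p | 0 ≤ cross a b p ∧ 0 ≤ cross b c p ∧ 0 ≤ cross c d p ∧ 0 ≤ cross d a p}
  have hC : IsClosed C := by
    refine .inter ?_ (.inter ?_ (.inter ?_ ?_)) <;>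
      exact isClosed_le continuous_const (continuous_cross _ _)
  have hdisj : Disjoint (innerRegion a b c d) (fourSegments a b c d) := by
    rw [disjoint_left]
    rintro p ⟨h1, h2, h3, h4⟩ (((h | h) | h) | h)
    exacts [h1.ne' (cross_eq_zero_of_mem_segment h), h2.ne' (cross_eq_zero_of_mem_segment h),
      h3.ne' (cross_eq_zero_of_mem_segment h), h4.ne' (cross_eq_zero_of_mem_segment h)]
  have hcover : (fourSegments a b c d)ᶜ ⊆ innerRegion a b c d ∪ Cᶜ := by
    intro p hp
    by_cases hpC : p ∈ C
    · obtain ⟨h1, h2, h3, h4⟩ := hpC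
      simp only [fourSegments, mem_compl_iff, mem_union, not_or] at hp
      obtain ⟨⟨⟨n1, n2⟩, n3⟩, n4⟩ := hp
      exact Or.inl ⟨h1.lt_of_ne fun e => n1 (h.mem_segment e.symm h2 h4),
        h2.lt_of_ne fun e => n2 (h.rotate.mem_segment e.symm h3 h1),
        h3.lt_of_ne fun e => n3 (h.rotate.rotate.mem_segment e.symm h4 h2),
        h4.lt_of_ne fun e => n4 (h.rotate.rotate.rotate.mem_segment e.symm h1 h3)⟩
    · exact Or.inr hpC
  have hCd : Disjoint (innerRegion a b c d) Cᶜ := by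
    rw [disjoint_compl_right_iff_subset]
    rintro p ⟨h1, h2, h3, h4⟩
    exact ⟨h1.le, h2.le, h3.le, h4.le⟩
  intro p hp
  have hpS : p ∈ (fourSegments a b c d)ᶜ := disjoint_left.1 hdisj hp
  refine ⟨hpS, h.isBounded_innerRegion.subset ?_⟩
  exact isPreconnected_connectedComponentIn.subset_left_of_subset_union
    (isOpen_innerRegion a b c d) hC.isOpen_compl hCd
    ((connectedComponentIn_subset _ _).trans hcover) ⟨p, mem_connectedComponentIn hpS, hp⟩

lemma PosConvex.openTriangle_subset {a b c d : Plane} (h : PosConvex a b c d) :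
    openTriangle a b c ⊆ innerRegion a b c d := by
  rintro p ⟨h1, h2, h3⟩
  -- Both identities expand an affine function of `p` in the barycentric coordinates of `p` relative
  -- to `a b c`.
  have e1 : cross a b c * cross c d p = cross b c p * cross c d a + cross c a p * cross b c d := by
    simp only [cross]; ring
  have e2 : cross a b c * cross d a p = cross c a p * cross d a b + cross a b p * cross c d a := by
    simp only [cross]; ring
  have := h.abc
  have := h.bcd
  have := h.cda
  have := h.dab
  exact ⟨h1, h2, pos_of_mul_pos_right (e1 ▸ by positivity) h.abc.le,
    pos_of_mul_pos_right (e2 ▸ by positivity) h.abc.le⟩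

/-- The open triangles on the two sides of the diagonal `a c` are disjoint and already have the full
shoelace area. -/
lemma PosConvex.le_volume_inside {a b c d : Plane} (h : PosConvex a b c d) :
    ENNReal.ofReal ((cross a b c + cross c d a) / 2) ≤
      volume (inside (fourSegments a b c d)) := by
  have h2 : openTriangle c d a ⊆ innerRegion a b c d := fun p hp =>
    let ⟨h1, h2, h3, h4⟩ := h.rotate.rotate.openTriangle_subset hp
    ⟨h3, h4, h1, h2⟩
  have hd : Disjoint (openTriangle a b c) (openTriangle c d a) := by
    rw [disjoint_left]
    rintro p ⟨-, -, hp⟩ ⟨-, -, hp'⟩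
    rw [cross_swap] at hp
    linarith
  refine le_trans (le_of_eq ?_) (measure_mono
    ((union_subset h.openTriangle_subset h2).trans h.innerRegion_subset_inside))
  rw [measure_union hd (isOpen_openTriangle c d a).measurableSet, volume_openTriangle h.abc,
    volume_openTriangle h.cda, add_div, ENNReal.ofReal_add (half_pos h.abc).le (half_pos h.cda).le]

/-! ### Bretschneider's formula and concyclicity -/

lemma dist_sq_eq (p q : Plane) : dist p q ^ 2 = (p 0 - q 0) ^ 2 + (p 1 - q 1) ^ 2 := by
  rw [EuclideanSpace.dist_eq, Real.sq_sqrt (by positivity), Fin.sum_univ_two, Real.dist_eq,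
    Real.dist_eq, sq_abs, sq_abs]

/-- The real part of `(a - b) (c - d) * conj ((b - c) (a - d))` in complex notation. -/
def crossRe (a b c d : Plane) : ℝ :=
  ((a 0 - b 0) * (c 0 - d 0) - (a 1 - b 1) * (c 1 - d 1)) *
    ((b 0 - c 0) * (a 0 - d 0) - (b 1 - c 1) * (a 1 - d 1)) +
  ((a 0 - b 0) * (c 1 - d 1) + (a 1 - b 1) * (c 0 - d 0)) *
    ((b 0 - c 0) * (a 1 - d 1) + (b 1 - c 1) * (a 0 - d 0))

/-- The imaginary part of `(a - b) (c - d) * conj ((b - c) (a - d))` in complex notation. It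
vanishes exactly if the four points lie on a circle or a line. -/
def crossIm (a b c d : Plane) : ℝ :=
  ((a 0 - b 0) * (c 1 - d 1) + (a 1 - b 1) * (c 0 - d 0)) *
    ((b 0 - c 0) * (a 0 - d 0) - (b 1 - c 1) * (a 1 - d 1)) -
  ((a 0 - b 0) * (c 0 - d 0) - (a 1 - b 1) * (c 1 - d 1)) *
    ((b 0 - c 0) * (a 1 - d 1) + (b 1 - c 1) * (a 0 - d 0))

lemma crossRe_sq_add_crossIm_sq (a b c d : Plane) :
    crossRe a b c d ^ 2 + crossIm a b c d ^ 2 =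
      (dist a b * dist b c * dist c d * dist d a) ^ 2 := by
  simp only [mul_pow, dist_sq_eq, crossRe, crossIm]
  ring

/-- Bretschneider's formula, in polynomial form. -/
lemma bretschneider (a b c d : Plane) :
    4 * (cross a b c + cross c d a) ^ 2 +
        8 * (dist a b * dist b c * dist c d * dist d a - crossRe a b c d) =
      (-dist a b + dist b c + dist c d + dist d a) * (dist a b - dist b c + dist c d + dist d a) *
      (dist a b + dist b c - dist c d + dist d a) *
      (dist a b + dist b c + dist c d - dist d a) := by
  -- Apart from the product of all four, the lengths now occur only through their squares, which are
  -- polynomials in the coordinates.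
  have e : ∀ x y z w : ℝ, (-x + y + z + w) * (x - y + z + w) * (x + y - z + w) * (x + y + z - w) =
      2 * (x ^ 2 * y ^ 2 + x ^ 2 * z ^ 2 + x ^ 2 * w ^ 2 + y ^ 2 * z ^ 2 + y ^ 2 * w ^ 2 +
        z ^ 2 * w ^ 2) - ((x ^ 2) ^ 2 + (y ^ 2) ^ 2 + (z ^ 2) ^ 2 + (w ^ 2) ^ 2) +
        8 * (x * y * z * w) := by
    intros; ring
  rw [e]
  simp only [dist_sq_eq, cross, crossRe]
  ring

/-- `o` is the circumcentre of `a b c`, found by Cramer's rule. The equation placing a point `p` on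
the circumcircle, multiplied by `cross a b c`, is the hypothesis of `key`; for `p = d` it amounts to
`crossIm a b c d = 0`. -/
lemma cospherical_of_crossIm_eq_zero {a b c d : Plane} (h : cross a b c ≠ 0)
    (hi : crossIm a b c d = 0) :
    ∃ (o : Plane) (r : ℝ), dist a o = r ∧ dist b o = r ∧ dist c o = r ∧ dist d o = r := by
  set m := (b 0 - a 0) ^ 2 + (b 1 - a 1) ^ 2 with hm
  set n := (c 0 - a 0) ^ 2 + (c 1 - a 1) ^ 2 with hn
  set x := ((c 1 - a 1) * m - (b 1 - a 1) * n) / (2 * cross a b c) with hx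
  set y := ((b 0 - a 0) * n - (c 0 - a 0) * m) / (2 * cross a b c) with hy
  have hx' : 2 * cross a b c * x = (c 1 - a 1) * m - (b 1 - a 1) * n := by
    rw [hx]; field_simp
  have hy' : 2 * cross a b c * y = (b 0 - a 0) * n - (c 0 - a 0) * m := by
    rw [hy]; field_simp
  set o : Plane := !₂[a 0 + x, a 1 + y] with ho
  have key : ∀ p : Plane, cross a b c * ((p 0 - a 0) ^ 2 + (p 1 - a 1) ^ 2) =
      (p 0 - a 0) * ((c 1 - a 1) * m - (b 1 - a 1) * n) +
      (p 1 - a 1) * ((b 0 - a 0) * n - (c 0 - a 0) * m) → dist p o = dist a o := by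
    intro p hp
    rw [← hx', ← hy'] at hp
    have hp' : (p 0 - a 0) ^ 2 + (p 1 - a 1) ^ 2 = 2 * ((p 0 - a 0) * x + (p 1 - a 1) * y) := by
      apply mul_left_cancel₀ h
      linear_combination hp
    rw [← sq_eq_sq₀ dist_nonneg dist_nonneg, dist_sq_eq, dist_sq_eq]
    simp only [ho, PiLp.toLp_apply, Matrix.cons_val_zero, Matrix.cons_val_one]
    linear_combination hp'
  refine ⟨o, dist a o, rfl, key b ?_, key c ?_, key d ?_⟩
  · simp only [hm, hn, cross]; ring
  · simp only [hm, hn, cross]; ring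
  · simp only [crossIm] at hi
    simp only [hm, hn, cross]
    linear_combination -hi

lemma crossIm_rotate_rotate (a b c d : Plane) : crossIm c d a b = crossIm a b c d := by
  simp only [crossIm]; ring

/-! ### Simple quadrilaterals and Brahmagupta's bound -/

lemma edgeSet_eq (Q : Polygon Plane 4) (i : Fin 4) :
    Q.edgeSet ℝ i = segment ℝ (Q i) (Q (finRotate 4 i)) :=
  affineSegment_eq_segment ℝ _ _

lemma boundary_eq (Q : Polygon Plane 4) :
    Q.boundary ℝ = fourSegments (Q 0) (Q 1) (Q 2) (Q 3) := by
  ext p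
  simp only [Polygon.boundary, mem_iUnion, edgeSet_eq]
  constructor
  · rintro ⟨i, hi⟩
    fin_cases i
    exacts [Or.inl (Or.inl (Or.inl hi)), Or.inl (Or.inl (Or.inr hi)), Or.inl (Or.inr hi),
      Or.inr hi]
  · rintro (((h | h) | h) | h)
    exacts [⟨0, h⟩, ⟨1, h⟩, ⟨2, h⟩, ⟨3, h⟩]

lemma area_eq (Q : Polygon Plane 4) :
    area Q = (volume (inside (fourSegments (Q 0) (Q 1) (Q 2) (Q 3)))).toReal := by
  rw [← boundary_eq]
  rfl

/-- Brahmagupta's expression for the area of a cyclic quadrilateral. -/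
def brahmagupta (l : Fin 4 → ℝ) : ℝ :=
  √(∏ i, ((∑ j, l j) / 2 - l i))

lemma brahmagupta_comp_perm (l : Fin 4 → ℝ) (σ : Equiv.Perm (Fin 4)) :
    brahmagupta (fun i => l (σ i)) = brahmagupta l := by
  unfold brahmagupta
  rw [Equiv.sum_comp σ l, Equiv.prod_comp σ fun i => (∑ j, l j) / 2 - l i]

lemma brahmagupta_pos {l : Fin 4 → ℝ} (h : ∀ i, 2 * l i < ∑ j, l j) : 0 < brahmagupta l :=
  Real.sqrt_pos.2 (Finset.prod_pos fun i _ => by linarith [h i])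

/-- The side lengths of a quadrilateral. -/
def sides (Q : Polygon Plane 4) (i : Fin 4) : ℝ :=
  dist (Q i) (Q (finRotate 4 i))

lemma IsFormedFrom.brahmagupta_sides {l : Fin 4 → ℝ} {Q : Polygon Plane 4}
    (h : IsFormedFrom l Q) : brahmagupta (sides Q) = brahmagupta l := by
  obtain ⟨-, σ, hσ⟩ := h
  rw [← brahmagupta_comp_perm l σ]
  exact congrArg _ (funext hσ)

lemma sides_eq (Q : Polygon Plane 4) : sides Q 0 = dist (Q 0) (Q 1) ∧
    sides Q 1 = dist (Q 1) (Q 2) ∧ sides Q 2 = dist (Q 2) (Q 3) ∧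
    sides Q 3 = dist (Q 3) (Q 0) := ⟨rfl, rfl, rfl, rfl⟩

/-- Opposite edges share no vertex, so the intersection that simplicity permits is empty. -/
lemma IsSimple.disjoint {Q : Polygon Plane 4} (h : IsSimple Q) :
    Disjoint (segment ℝ (Q 0) (Q 1)) (segment ℝ (Q 2) (Q 3)) ∧
    Disjoint (segment ℝ (Q 1) (Q 2)) (segment ℝ (Q 3) (Q 0)) := by
  obtain ⟨hinj, hedge⟩ := h
  have hne : ∀ i j : Fin 4, i ≠ j → Q i ≠ Q j := fun i j hij e => hij (hinj e)
  constructor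
  · rw [disjoint_left]
    intro p hp hp'
    have := hedge 0 2 (by decide) ⟨(edgeSet_eq Q 0).symm ▸ hp, (edgeSet_eq Q 2).symm ▸ hp'⟩
    rcases this with ⟨rfl | rfl, h | h⟩
    exacts [hne 0 2 (by decide) h, hne 0 3 (by decide) h, hne 1 2 (by decide) h,
      hne 1 3 (by decide) h]
  · rw [disjoint_left]
    intro p hp hp'
    have := hedge 1 3 (by decide) ⟨(edgeSet_eq Q 1).symm ▸ hp, (edgeSet_eq Q 3).symm ▸ hp'⟩
    rcases this with ⟨rfl | rfl, h | h⟩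
    exacts [hne 1 3 (by decide) h, hne 1 0 (by decide) h, hne 2 3 (by decide) h,
      hne 2 0 (by decide) h]

lemma IsSimple.area_le {Q : Polygon Plane 4} (h : IsSimple Q) :
    area Q ≤ |cross (Q 0) (Q 1) (Q 2) + cross (Q 2) (Q 3) (Q 0)| / 2 := by
  rw [area_eq]
  refine ENNReal.toReal_le_of_le_ofReal (by positivity) ?_
  exact volume_inside_le (fun e => absurd (h.1 e) (by decide)) h.disjoint.1 h.disjoint.2

lemma brahmagupta_prod (Q : Polygon Plane 4) :
    16 * ∏ i, ((∑ j, sides Q j) / 2 - sides Q i) =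
      4 * (cross (Q 0) (Q 1) (Q 2) + cross (Q 2) (Q 3) (Q 0)) ^ 2 +
        8 * (dist (Q 0) (Q 1) * dist (Q 1) (Q 2) * dist (Q 2) (Q 3) * dist (Q 3) (Q 0) -
          crossRe (Q 0) (Q 1) (Q 2) (Q 3)) := by
  rw [bretschneider, Fin.prod_univ_four, Fin.sum_univ_four, (sides_eq Q).1, (sides_eq Q).2.1,
    (sides_eq Q).2.2.1, (sides_eq Q).2.2.2]
  ring

/-- A real part is at most the modulus, so the correction term in Bretschneider's formula is
nonnegative. -/
lemma abs_shoelace_le_brahmagupta (Q : Polygon Plane 4) :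
    |cross (Q 0) (Q 1) (Q 2) + cross (Q 2) (Q 3) (Q 0)| / 2 ≤ brahmagupta (sides Q) := by
  have h1 := brahmagupta_prod Q
  have h2 := crossRe_sq_add_crossIm_sq (Q 0) (Q 1) (Q 2) (Q 3)
  have h3 : crossRe (Q 0) (Q 1) (Q 2) (Q 3) ≤
      dist (Q 0) (Q 1) * dist (Q 1) (Q 2) * dist (Q 2) (Q 3) * dist (Q 3) (Q 0) :=
    le_of_sq_le_sq (by linarith [sq_nonneg (crossIm (Q 0) (Q 1) (Q 2) (Q 3))]) (by positivity)
  refine Real.le_sqrt_of_sq_le ?_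
  rw [div_pow, sq_abs]
  linarith

/-- Equality makes the real part equal to the modulus, so the imaginary part vanishes. Positive area
ensures that one of the two triangles cut off by the diagonal is nondegenerate and has a
circumcircle. -/
lemma isCyclic_of_abs_shoelace_eq {Q : Polygon Plane 4}
    (h : |cross (Q 0) (Q 1) (Q 2) + cross (Q 2) (Q 3) (Q 0)| / 2 = brahmagupta (sides Q))
    (hpos : 0 < brahmagupta (sides Q)) : IsCyclic Q := by
  have h1 := brahmagupta_prod Q
  have h2 := crossRe_sq_add_crossIm_sq (Q 0) (Q 1) (Q 2) (Q 3)
  have h4 : brahmagupta (sides Q) ^ 2 = ∏ i, ((∑ j, sides Q j) / 2 - sides Q i) :=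
    Real.sq_sqrt (Real.sqrt_pos.1 hpos).le
  rw [← h, div_pow, sq_abs] at h4
  have h5 : crossRe (Q 0) (Q 1) (Q 2) (Q 3) =
      dist (Q 0) (Q 1) * dist (Q 1) (Q 2) * dist (Q 2) (Q 3) * dist (Q 3) (Q 0) := by linarith
  have h6 : crossIm (Q 0) (Q 1) (Q 2) (Q 3) = 0 := by
    rw [h5] at h2
    exact pow_eq_zero_iff two_ne_zero |>.1 (by linarith)
  have fin : ∀ (o : Plane) (r : ℝ), dist (Q 0) o = r → dist (Q 1) o = r → dist (Q 2) o = r →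
      dist (Q 3) o = r → IsCyclic Q := by
    intro o r e0 e1 e2 e3
    refine ⟨o, r, ?_⟩
    rintro _ ⟨i, rfl⟩
    fin_cases i
    exacts [e0, e1, e2, e3]
  by_cases hz : cross (Q 0) (Q 1) (Q 2) = 0
  · have hz' : cross (Q 2) (Q 3) (Q 0) ≠ 0 := by
      intro hz'
      rw [hz, hz'] at h
      simp at h
      exact hpos.ne h
    obtain ⟨o, r, e2, e3, e0, e1⟩ := cospherical_of_crossIm_eq_zero hz'
      ((crossIm_rotate_rotate _ _ _ _).trans h6)
    exact fin o r e0 e1 e2 e3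
  · obtain ⟨o, r, e0, e1, e2, e3⟩ := cospherical_of_crossIm_eq_zero hz h6
    exact fin o r e0 e1 e2 e3

lemma dist_lt_of_notMem_segment {a b c : Plane} (h : c ∉ segment ℝ a b) (d : Plane) :
    dist a b < dist b c + dist c d + dist d a := by
  have h1 : dist a b < dist a c + dist c b := by
    refine lt_of_le_of_ne (dist_triangle a c b) fun e => h ?_
    rw [← affineSegment_eq_segment]
    exact dist_add_dist_eq_iff.1 e.symm
  have h2 := dist_triangle c d a
  rw [dist_comm a c, dist_comm c b] at h1
  linarith

lemma IsSimple.sides_pos {Q : Polygon Plane 4} (h : IsSimple Q) (i : Fin 4) : 0 < sides Q i := by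
  have hi : ∀ i : Fin 4, i ≠ finRotate 4 i := by decide
  exact dist_pos.2 fun e => hi i (h.1 e)

/-- An endpoint of the opposite side is not on the given side, which makes the triangle inequality
strict. -/
lemma IsSimple.two_mul_sides_lt {Q : Polygon Plane 4} (h : IsSimple Q) (i : Fin 4) :
    2 * sides Q i < ∑ j, sides Q j := by
  obtain ⟨h1, h2⟩ := h.disjoint
  rw [Fin.sum_univ_four, (sides_eq Q).1, (sides_eq Q).2.1, (sides_eq Q).2.2.1, (sides_eq Q).2.2.2]
  have e1 := dist_lt_of_notMem_segment (disjoint_right.1 h1 (left_mem_segment ℝ _ _)) (Q 3)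
  have e2 := dist_lt_of_notMem_segment (disjoint_right.1 h2 (left_mem_segment ℝ _ _)) (Q 0)
  have e3 := dist_lt_of_notMem_segment (disjoint_left.1 h1 (left_mem_segment ℝ _ _)) (Q 1)
  have e4 := dist_lt_of_notMem_segment (disjoint_left.1 h2 (left_mem_segment ℝ _ _)) (Q 2)
  fin_cases i
  · change 2 * dist (Q 0) (Q 1) < _
    linarith
  · change 2 * dist (Q 1) (Q 2) < _
    linarith
  · change 2 * dist (Q 2) (Q 3) < _
    linarith
  · change 2 * dist (Q 3) (Q 0) < _
    linarith

lemma PosConvex.isSimple {a b c d : Plane} (h : PosConvex a b c d) :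
    IsSimple (⟨![a, b, c, d]⟩ : Polygon Plane 4) := by
  have hab : a ≠ b := ne_of_cross_ne_zero h.abc.ne'
  have hbc : b ≠ c := ne_of_cross_ne_zero h.bcd.ne'
  have hcd : c ≠ d := ne_of_cross_ne_zero h.cda.ne'
  have hda : d ≠ a := ne_of_cross_ne_zero h.dab.ne'
  have hac : a ≠ c := by
    rintro rfl
    exact h.abc.ne' (cross_self_left _ _)
  have hbd : b ≠ d := by
    rintro rfl
    exact h.bcd.ne' (cross_self_left _ _)
  set Q : Polygon Plane 4 := ⟨![a, b, c, d]⟩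
  have hadj : ∀ i, Q.edgeSet ℝ i ∩ Q.edgeSet ℝ (finRotate 4 i) ⊆ {Q (finRotate 4 i)} := by
    intro i
    rw [edgeSet_eq, edgeSet_eq]
    fin_cases i
    exacts [h.inter_subset, h.rotate.inter_subset, h.rotate.rotate.inter_subset,
      h.rotate.rotate.rotate.inter_subset]
  have hopp : ∀ i, Disjoint (Q.edgeSet ℝ i) (Q.edgeSet ℝ (finRotate 4 (finRotate 4 i))) := by
    intro i
    rw [edgeSet_eq, edgeSet_eq]
    fin_cases i
    exacts [h.disjoint, h.rotate.disjoint, h.rotate.rotate.disjoint,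
      h.rotate.rotate.rotate.disjoint]
  have hcases : ∀ i j : Fin 4, i ≠ j →
      j = finRotate 4 i ∨ i = finRotate 4 j ∨ j = finRotate 4 (finRotate 4 i) := by decide
  refine ⟨?_, fun i j hij => ?_⟩
  · intro i j hij
    fin_cases i <;> fin_cases j <;>
      first
      | rfl
      | exact absurd hij (by first | assumption | (apply Ne.symm; assumption))
  · rcases hcases i j hij with rfl | rfl | rfl
    · intro p hp
      rw [mem_singleton_iff.1 (hadj i hp)]
      exact ⟨Or.inr rfl, Or.inl rfl⟩
    · intro p hp
      rw [mem_singleton_iff.1 (hadj j hp.symm)]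
      exact ⟨Or.inl rfl, Or.inr rfl⟩
    · rw [disjoint_iff_inter_eq_empty.1 (hopp i)]
      exact empty_subset _

/-- For sides satisfying the quadrilateral inequality there is a strictly convex quadrilateral
attaining Brahmagupta's expression. -/
lemma exists_posConvex {x y z w : ℝ} (hx : 0 < x) (hy : 0 < y) (hz : 0 < z) (hw : 0 < w)
    (h1 : x < y + z + w) (h2 : y < x + z + w) (h3 : z < x + y + w) (h4 : w < x + y + z) :
    ∃ a b c d : Plane, PosConvex a b c d ∧ dist a b = x ∧ dist b c = y ∧ dist c d = z ∧
      dist d a = w ∧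
      4 * (cross a b c + cross c d a) ^ 2 =
        (-x + y + z + w) * (x - y + z + w) * (x + y - z + w) * (x + y + z - w) := by
  set N := (-x + y + z + w) * (x - y + z + w) * (x + y - z + w) * (x + y + z - w) with hN
  have hNpos : 0 < N := by
    have g1 : 0 < -x + y + z + w := by linarith
    have g2 : 0 < x - y + z + w := by linarith
    have g3 : 0 < x + y - z + w := by linarith
    have g4 : 0 < x + y + z - w := by linarith
    positivity
  -- The target is the cyclic quadrilateral with diagonal `a c` on the first axis. Then `e` is the
  -- classical value of the squared diagonal, and `k` below is four times the area. Opposite angles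
  -- have equal sines, so the diagonal splits the area in the ratio `x * y : z * w`, which gives the
  -- altitudes `u` and `v`.
  set m := x * y + z * w with hm
  have hmpos : 0 < m := by positivity
  set e := (x * z + y * w) * (x * w + y * z) / m with he
  have hepos : 0 < e := by positivity
  set p := √e with hp
  have hppos : 0 < p := Real.sqrt_pos.2 hepos
  have hp2 : p ^ 2 = e := Real.sq_sqrt hepos.le
  have hem : e * m = (x * z + y * w) * (x * w + y * z) := by rw [he]; field_simp
  set k := √N with hk
  have hkpos : 0 < k := Real.sqrt_pos.2 hNpos
  have hk2 : k ^ 2 = N := Real.sq_sqrt hNpos.le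
  -- the feet of the altitudes on the diagonal, and the altitudes
  set s := (x ^ 2 + e - y ^ 2) / (2 * p) with hs
  set t := (w ^ 2 + e - z ^ 2) / (2 * p) with ht
  set u := k * (x * y) / (2 * p * m) with hu
  set v := k * (z * w) / (2 * p * m) with hv
  have hupos : 0 < u := by positivity
  have hvpos : 0 < v := by positivity
  have hs2 : 2 * p * s = x ^ 2 + e - y ^ 2 := by rw [hs]; field_simp
  have ht2 : 2 * p * t = w ^ 2 + e - z ^ 2 := by rw [ht]; field_simp
  have hu2 : 2 * p * m * u = k * (x * y) := by rw [hu]; field_simp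
  have hv2 : 2 * p * m * v = k * (z * w) := by rw [hv]; field_simp
  have h4 : 4 * e * m ^ 2 ≠ 0 := by positivity
  have h4' : 0 < 4 * e * m := by positivity
  have hsu : s ^ 2 + u ^ 2 = x ^ 2 := by
    apply mul_left_cancel₀ h4
    calc 4 * e * m ^ 2 * (s ^ 2 + u ^ 2) = (2 * p * s) ^ 2 * m ^ 2 + (2 * p * m * u) ^ 2 := by
          rw [← hp2]; ring
      _ = ((x ^ 2 - y ^ 2) * m + e * m) ^ 2 + N * (x * y) ^ 2 := by
          rw [hs2, hu2, mul_pow k, hk2]; ring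
      _ = 4 * (e * m) * m * x ^ 2 := by rw [hem, hm, hN]; ring
      _ = 4 * e * m ^ 2 * x ^ 2 := by ring
  have htv : t ^ 2 + v ^ 2 = w ^ 2 := by
    apply mul_left_cancel₀ h4
    calc 4 * e * m ^ 2 * (t ^ 2 + v ^ 2) = (2 * p * t) ^ 2 * m ^ 2 + (2 * p * m * v) ^ 2 := by
          rw [← hp2]; ring
      _ = ((w ^ 2 - z ^ 2) * m + e * m) ^ 2 + N * (z * w) ^ 2 := by
          rw [ht2, hv2, mul_pow k, hk2]; ring
      _ = 4 * (e * m) * m * w ^ 2 := by rw [hem, hm, hN]; ring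
      _ = 4 * e * m ^ 2 * w ^ 2 := by ring
  have hsu' : (p - s) ^ 2 + u ^ 2 = y ^ 2 := by linear_combination hsu + hp2 - hs2
  have htv' : (p - t) ^ 2 + v ^ 2 = z ^ 2 := by linear_combination htv + hp2 - ht2
  -- Convexity at `a`, and next at `c`. It is not automatic, since the feet of the altitudes may
  -- fall outside the diagonal; the factor `4 * e * m` clears denominators.
  have hγ : 0 < t * u + v * s := by
    refine pos_of_mul_pos_right (a := 4 * e * m) ?_ h4'.le
    have : 4 * e * m * (t * u + v * s) = k * (2 * x * w * (x * z + y * w)) := by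
      calc 4 * e * m * (t * u + v * s)
          = (2 * p * t) * (2 * p * m * u) + (2 * p * m * v) * (2 * p * s) := by rw [← hp2]; ring
        _ = k * (e * m + x * y * (w ^ 2 - z ^ 2) + z * w * (x ^ 2 - y ^ 2)) := by
            rw [ht2, hu2, hv2, hs2, hm]; ring
        _ = _ := by rw [hem]; ring
    rw [this]; positivity
  have hα : 0 < (p - s) * v + (p - t) * u := by
    refine pos_of_mul_pos_right (a := 4 * e * m) ?_ h4'.le
    have : 4 * e * m * ((p - s) * v + (p - t) * u) = k * (2 * y * z * (x * z + y * w)) := by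
      calc 4 * e * m * ((p - s) * v + (p - t) * u)
          = (2 * p ^ 2 - 2 * p * s) * (2 * p * m * v) + (2 * p ^ 2 - 2 * p * t) * (2 * p * m * u) := by
            rw [← hp2]; ring
        _ = k * (e * m - x * y * (w ^ 2 - z ^ 2) - z * w * (x ^ 2 - y ^ 2)) := by
            rw [ht2, hu2, hv2, hs2, hp2, hm]; ring
        _ = _ := by rw [hem]; ring
    rw [this]; positivity
  have huv : 2 * (p * u + p * v) = k := by
    rw [hu, hv]; field_simp; ring
  refine ⟨!₂[0, 0], !₂[s, -u], !₂[p, 0], !₂[t, v], ⟨?_, ?_, ?_, ?_⟩, ?_, ?_, ?_, ?_, ?_⟩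
  · simp [cross]; positivity
  · simp [cross]; linarith
  · simp [cross]; nlinarith
  · simp [cross]; linarith
  · rw [← sq_eq_sq₀ dist_nonneg hx.le, dist_sq_eq]
    simpa using hsu
  · rw [← sq_eq_sq₀ dist_nonneg hy.le, dist_sq_eq, ← hsu']
    simp; ring
  · rw [← sq_eq_sq₀ dist_nonneg hz.le, dist_sq_eq, ← htv']
    simp
  · rw [← sq_eq_sq₀ dist_nonneg hw.le, dist_sq_eq, ← htv]
    simp
  · rw [← hk2, ← huv]
    simp [cross]; ring

/-- The conditions on four lengths under which they are the sides of a quadrilateral. -/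
def QuadIneq (l : Fin 4 → ℝ) : Prop := ∀ i, 0 < l i ∧ 2 * l i < ∑ j, l j

lemma IsFormedFrom.quadIneq {l : Fin 4 → ℝ} {Q : Polygon Plane 4} (h : IsFormedFrom l Q) :
    QuadIneq l := by
  obtain ⟨hs, σ, hσ⟩ := h
  have e : ∀ i, l i = sides Q (σ.symm i) := fun i => by
    rw [sides, hσ, Equiv.apply_symm_apply]
  intro i
  simp only [e, Equiv.sum_comp σ.symm (sides Q)]
  exact ⟨hs.sides_pos _, hs.two_mul_sides_lt _⟩

lemma IsFormedFrom.area_le {l : Fin 4 → ℝ} {Q : Polygon Plane 4} (h : IsFormedFrom l Q) :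
    area Q ≤ brahmagupta l :=
  h.brahmagupta_sides ▸ h.1.area_le.trans (abs_shoelace_le_brahmagupta Q)

lemma IsFormedFrom.isCyclic {l : Fin 4 → ℝ} {Q : Polygon Plane 4} (h : IsFormedFrom l Q)
    (he : area Q = brahmagupta l) : IsCyclic Q := by
  have hb := h.brahmagupta_sides
  refine isCyclic_of_abs_shoelace_eq (le_antisymm (abs_shoelace_le_brahmagupta Q) ?_) ?_
  · rw [hb, ← he]
    exact h.1.area_le
  · rw [hb]
    exact brahmagupta_pos fun i => (h.quadIneq i).2

lemma QuadIneq.exists_area_eq {l : Fin 4 → ℝ} (h : QuadIneq l) :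
    ∃ Q : Polygon Plane 4, IsFormedFrom l Q ∧ area Q = brahmagupta l := by
  have hs : ∀ i, 2 * l i < l 0 + l 1 + l 2 + l 3 := fun i => by
    rw [← Fin.sum_univ_four]
    exact (h i).2
  obtain ⟨a, b, c, d, hconv, e0, e1, e2, e3, hN⟩ := exists_posConvex (h 0).1 (h 1).1 (h 2).1 (h 3).1
    (by linarith [hs 0]) (by linarith [hs 1]) (by linarith [hs 2]) (by linarith [hs 3])
  have hf : IsFormedFrom l (⟨![a, b, c, d]⟩ : Polygon Plane 4) := by
    refine ⟨hconv.isSimple, Equiv.refl _, fun i => ?_⟩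
    fin_cases i
    exacts [e0, e1, e2, e3]
  refine ⟨_, hf, le_antisymm hf.area_le ?_⟩
  have hle := hconv.le_volume_inside
  -- `area` is a real-valued measure and would be 0 on a region of infinite measure.
  have hfin : volume (inside (fourSegments a b c d)) ≠ ⊤ :=
    ne_top_of_le_ne_top ENNReal.ofReal_ne_top
      (volume_inside_le (fun e => hconv.abc.ne' (e ▸ cross_self_left a b)) hconv.disjoint
        hconv.rotate.disjoint)
  rw [area_eq]
  refine le_trans ?_ ((ENNReal.ofReal_le_iff_le_toReal hfin).1 hle)
  refine Real.sqrt_le_iff.2 ⟨by have := hconv.abc; have := hconv.cda; positivity, ?_⟩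
  rw [Fin.prod_univ_four, Fin.sum_univ_four]
  linarith

lemma exists_isFormedFrom_iff {l : Fin 4 → ℝ} :
    (∃ Q : Polygon Plane 4, IsFormedFrom l Q) ↔ QuadIneq l :=
  ⟨fun ⟨_, h⟩ => h.quadIneq, fun h => let ⟨Q, hQ, _⟩ := h.exists_area_eq; ⟨Q, hQ⟩⟩

lemma QuadIneq.exists_isMaximalFrom {l : Fin 4 → ℝ} (h : QuadIneq l) :
    ∃ Q : Polygon Plane 4, IsMaximalFrom l Q :=
  let ⟨Q, hQ, he⟩ := h.exists_area_eq
  ⟨Q, hQ, fun _ hR => he ▸ hR.area_le⟩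

lemma IsMaximalFrom.isCyclic {l : Fin 4 → ℝ} {Q : Polygon Plane 4} (h : IsMaximalFrom l Q) :
    IsCyclic Q := by
  obtain ⟨R, hR, he⟩ := h.1.quadIneq.exists_area_eq
  exact h.1.isCyclic (le_antisymm h.1.area_le (he ▸ h.2 R hR))

lemma QuadIneq.maxArea_eq {l : Fin 4 → ℝ} (h : QuadIneq l) : maxArea l = brahmagupta l := by
  refine IsGreatest.csSup_eq ⟨h.exists_area_eq, ?_⟩
  rintro _ ⟨Q, hQ, rfl⟩
  exact hQ.area_le

/-! ### Product densities on the simplex -/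

/-- The integral of a product density over the plane `x + y + z + t = 1`. -/
def simplexIntegral (f g h k : ℝ → ℝ≥0∞) : ℝ≥0∞ :=
  ∫⁻ x, ∫⁻ y, ∫⁻ z, f x * g y * h z * k (1 - x - y - z)

section simplexIntegral

variable {f g h k : ℝ → ℝ≥0∞}

/-- The three adjacent transpositions move a distinguished factor to the first place, which
identifies the four caps of the truncated simplex. -/
lemma simplexIntegral_swap₁₂ (hf : Measurable f) (hg : Measurable g) (hh : Measurable h)
    (hk : Measurable k) : simplexIntegral f g h k = simplexIntegral g f h k := by
  unfold simplexIntegral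
  rw [lintegral_lintegral_swap]
  · refine lintegral_congr fun x => lintegral_congr fun y => lintegral_congr fun z => ?_
    rw [mul_comm (f y), sub_right_comm 1 y x]
  · exact (Measurable.lintegral_prod_right' (f := fun q : (ℝ × ℝ) × ℝ =>
      f q.1.1 * g q.1.2 * h q.2 * k (1 - q.1.1 - q.1.2 - q.2)) (by fun_prop)).aemeasurable

lemma simplexIntegral_swap₂₃ (hg : Measurable g) (hh : Measurable h)
    (hk : Measurable k) : simplexIntegral f g h k = simplexIntegral f h g k := by
  unfold simplexIntegral
  refine lintegral_congr fun x => ?_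
  rw [lintegral_lintegral_swap]
  · refine lintegral_congr fun y => lintegral_congr fun z => ?_
    rw [mul_right_comm (f x), sub_right_comm (1 - x) z y]
  · exact Measurable.aemeasurable (f := fun q : ℝ × ℝ =>
      f x * g q.1 * h q.2 * k (1 - x - q.1 - q.2)) (by fun_prop)

lemma simplexIntegral_swap₃₄ : simplexIntegral f g h k = simplexIntegral f g k h := by
  unfold simplexIntegral
  refine lintegral_congr fun x => lintegral_congr fun y => ?_
  rw [← lintegral_sub_left_eq_self _ (1 - x - y)]
  refine lintegral_congr fun z => ?_
  rw [sub_sub_cancel, mul_right_comm]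

lemma simplexIntegral_eq_lintegral (hg : Measurable g) (hh : Measurable h)
    (hk : Measurable k) : simplexIntegral f g h k =
      ∫⁻ x, f x * ∫⁻ y, g y * ∫⁻ z, h z * k (1 - x - y - z) := by
  unfold simplexIntegral
  refine lintegral_congr fun x => ?_
  rw [← lintegral_const_mul]
  · refine lintegral_congr fun y => ?_
    rw [← mul_assoc, ← lintegral_const_mul _ (by fun_prop)]
    simp only [mul_assoc]
  · refine hg.mul ?_
    exact Measurable.lintegral_prod_right' (f := fun q : ℝ × ℝ => h q.2 * k (1 - x - q.1 - q.2))
      (by fun_prop)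

/-- Inclusion-exclusion for the part of the simplex where all coordinates are below `1 / 2`. -/
lemma simplexIntegral_truncate {w : ℝ → ℝ≥0∞} (hw : Measurable w) (h0 : ∀ y ≤ 0, w y = 0) :
    simplexIntegral w w w w =
      simplexIntegral ((Iio (1 / 2)).indicator w) ((Iio (1 / 2)).indicator w)
        ((Iio (1 / 2)).indicator w) ((Iio (1 / 2)).indicator w) +
      4 * simplexIntegral ((Ici (1 / 2)).indicator w) w w w := by
  set φ := (Iio (1 / 2 : ℝ)).indicator w with hφ
  set χ := (Ici (1 / 2 : ℝ)).indicator w with hχ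
  have mφ : Measurable φ := hw.indicator measurableSet_Iio
  have mχ : Measurable χ := hw.indicator measurableSet_Ici
  -- Positive coordinates with sum 1 include at most one that is `≥ 1 / 2`, so at most one of the
  -- five summands is nonzero. If some coordinate is `≤ 0`, both sides vanish by `h0`.
  have key : ∀ x y z : ℝ, w x * w y * w z * w (1 - x - y - z) =
      φ x * φ y * φ z * φ (1 - x - y - z) + (χ x * w y * w z * w (1 - x - y - z) +
      (w x * χ y * w z * w (1 - x - y - z) + (w x * w y * χ z * w (1 - x - y - z) +
        w x * w y * w z * χ (1 - x - y - z)))) := by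
    intro x y z
    have hφ1 : ∀ {t : ℝ}, t < 1 / 2 → φ t = w t := fun ht =>
      indicator_of_mem (mem_Iio.2 ht) w
    have hχ1 : ∀ {t : ℝ}, t < 1 / 2 → χ t = 0 := fun ht =>
      indicator_of_notMem (notMem_Ici.2 ht) w
    have hφ2 : ∀ {t : ℝ}, 1 / 2 ≤ t → φ t = 0 := fun ht =>
      indicator_of_notMem (notMem_Iio.2 ht) w
    have hχ2 : ∀ {t : ℝ}, 1 / 2 ≤ t → χ t = w t := fun ht =>
      indicator_of_mem (mem_Ici.2 ht) w
    have z0 : ∀ {t : ℝ}, t ≤ 0 → φ t = 0 ∧ χ t = 0 := fun {t} ht =>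
      ⟨by rw [hφ1 (by linarith), h0 t ht], hχ1 (by linarith)⟩
    rcases le_or_gt x 0 with hx | hx
    · simp [h0 x hx, z0 hx]
    rcases le_or_gt y 0 with hy | hy
    · simp [h0 y hy, z0 hy]
    rcases le_or_gt z 0 with hz | hz
    · simp [h0 z hz, z0 hz]
    rcases le_or_gt (1 - x - y - z) 0 with ht | ht
    · simp [h0 _ ht, z0 ht]
    rcases lt_or_ge x (1 / 2) with hx' | hx'
    · rcases lt_or_ge y (1 / 2) with hy' | hy'
      · rcases lt_or_ge z (1 / 2) with hz' | hz'
        · rcases lt_or_ge (1 - x - y - z) (1 / 2) with ht' | ht'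
          · simp [hφ1 hx', hφ1 hy', hφ1 hz', hφ1 ht', hχ1 hx', hχ1 hy', hχ1 hz', hχ1 ht']
          · simp [hχ1 hx', hχ1 hy', hχ1 hz', hφ2 ht', hχ2 ht']
        · simp [hχ1 hx', hχ1 hy', hφ2 hz', hχ2 hz',
            hχ1 (show 1 - x - y - z < 1 / 2 by linarith)]
      · simp [hχ1 hx', hφ2 hy', hχ2 hy', hχ1 (show z < 1 / 2 by linarith),
          hχ1 (show 1 - x - y - z < 1 / 2 by linarith)]
    · simp [hφ2 hx', hχ2 hx', hχ1 (show y < 1 / 2 by linarith),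
        hχ1 (show z < 1 / 2 by linarith), hχ1 (show 1 - x - y - z < 1 / 2 by linarith)]
  have add : ∀ F G : ℝ → ℝ → ℝ → ℝ≥0∞, Measurable (fun q : (ℝ × ℝ) × ℝ => F q.1.1 q.1.2 q.2) →
      ∫⁻ x, ∫⁻ y, ∫⁻ z, F x y z + G x y z =
        (∫⁻ x, ∫⁻ y, ∫⁻ z, F x y z) + ∫⁻ x, ∫⁻ y, ∫⁻ z, G x y z := by
    intro F G hF
    have h1 : Measurable fun q : ℝ × ℝ => ∫⁻ z, F q.1 q.2 z := hF.lintegral_prod_right'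
    have h2 : Measurable fun x => ∫⁻ y, ∫⁻ z, F x y z := h1.lintegral_prod_right'
    rw [← lintegral_add_left h2]
    refine lintegral_congr fun x => ?_
    rw [← lintegral_add_left (show Measurable fun y => ∫⁻ z, F x y z from
      h1.comp measurable_prodMk_left)]
    refine lintegral_congr fun y => ?_
    rw [← lintegral_add_left]
    exact hF.comp (measurable_prodMk_left (x := (x, y)))
  have e1 : simplexIntegral w χ w w = simplexIntegral χ w w w :=
    simplexIntegral_swap₁₂ hw mχ hw hw
  have e2 : simplexIntegral w w χ w = simplexIntegral χ w w w :=
    (simplexIntegral_swap₂₃ hw mχ hw).trans e1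
  have e3 : simplexIntegral w w w χ = simplexIntegral χ w w w := simplexIntegral_swap₃₄.trans e2
  have expand : simplexIntegral w w w w = simplexIntegral φ φ φ φ + (simplexIntegral χ w w w +
      (simplexIntegral w χ w w + (simplexIntegral w w χ w + simplexIntegral w w w χ))) := by
    unfold simplexIntegral
    simp only [key]
    rw [add _ _ (by fun_prop), add _ _ (by fun_prop), add _ _ (by fun_prop), add _ _ (by fun_prop)]
  rw [expand, e1, e2, e3]
  ring

end simplexIntegral

/-- The function `g` on the positive half-line, as a density. -/
def posDensity (g : ℝ → ℝ) : ℝ → ℝ≥0∞ :=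
  (Ioi 0).indicator fun x => ENNReal.ofReal (g x)

lemma measurable_posDensity {g : ℝ → ℝ} (hg : Continuous g) : Measurable (posDensity g) :=
  (hg.measurable.ennreal_ofReal).indicator measurableSet_Ioi

lemma posDensity_of_nonpos (g : ℝ → ℝ) {x : ℝ} (hx : x ≤ 0) : posDensity g x = 0 :=
  indicator_of_notMem (notMem_Ioi.2 hx) _

lemma posDensity_of_pos (g : ℝ → ℝ) {x : ℝ} (hx : 0 < x) :
    posDensity g x = ENNReal.ofReal (g x) :=
  indicator_of_mem (mem_Ioi.2 hx) _

lemma lintegral_indicator_posDensity {g h : ℝ → ℝ} (hg : Continuous g) (hh : Continuous h)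
    (hg0 : ∀ x, 0 ≤ x → 0 ≤ g x) (hh0 : ∀ x, 0 ≤ x → 0 ≤ h x) {c s : ℝ} (hc : 0 ≤ c)
    (hcs : c ≤ s) :
    ∫⁻ x, (Ici c).indicator (posDensity g) x * posDensity h (s - x) =
      ENNReal.ofReal (∫ x in c..s, g x * h (s - x)) := by
  rw [intervalIntegral.integral_of_le hcs, ofReal_integral_eq_lintegral_ofReal,
    ← lintegral_indicator measurableSet_Ioc]
  · have h1 : ∀ᵐ x : ℝ, x ≠ c := by simp [ae_iff]
    have h2 : ∀ᵐ x : ℝ, x ≠ s := by simp [ae_iff]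
    refine lintegral_congr_ae ?_
    filter_upwards [h1, h2] with x hx1 hx2
    rcases lt_or_gt_of_ne hx1 with hlt | hlt
    · rw [indicator_of_notMem (notMem_Ici.2 hlt), zero_mul, indicator_of_notMem]
      exact fun hx => hlt.not_gt hx.1
    · rw [indicator_of_mem (mem_Ici.2 hlt.le), posDensity_of_pos g (hc.trans_lt hlt)]
      rcases lt_or_gt_of_ne hx2 with h' | h'
      · rw [posDensity_of_pos h (sub_pos.2 h'), indicator_of_mem (mem_Ioc.2 ⟨hlt, h'.le⟩),
          ENNReal.ofReal_mul (hg0 x (by linarith))]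
      · rw [posDensity_of_nonpos h (by linarith), mul_zero, indicator_of_notMem]
        exact fun hx => h'.not_ge hx.2
  · exact (Continuous.integrableOn_Icc (by fun_prop)).mono_set Ioc_subset_Icc_self
  · refine (ae_restrict_mem measurableSet_Ioc).mono fun x hx => ?_
    exact mul_nonneg (hg0 x (hc.trans hx.1.le)) (hh0 _ (sub_nonneg.2 hx.2))

/-- The convolution of two densities on the half-line is again such a density, so the step can be
iterated. For `s ≤ 0` one of the arguments is always nonpositive. -/
lemma lintegral_posDensity_mul {g h : ℝ → ℝ} (hg : Continuous g) (hh : Continuous h)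
    (hg0 : ∀ x, 0 ≤ x → 0 ≤ g x) (hh0 : ∀ x, 0 ≤ x → 0 ≤ h x) {I : ℝ → ℝ}
    (hI : ∀ s, 0 < s → ∫ x in (0 : ℝ)..s, g x * h (s - x) = I s) (s : ℝ) :
    ∫⁻ x, posDensity g x * posDensity h (s - x) = posDensity I s := by
  rcases le_or_gt s 0 with hs | hs
  · rw [posDensity_of_nonpos I hs, ← lintegral_zero (μ := (volume : Measure ℝ))]
    refine lintegral_congr fun x => ?_
    rcases le_or_gt x 0 with hx | hx
    · rw [posDensity_of_nonpos g hx, zero_mul]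
    · rw [posDensity_of_nonpos h (by linarith), mul_zero]
  · rw [posDensity_of_pos I hs, ← hI s hs,
      ← lintegral_indicator_posDensity hg hh hg0 hh0 le_rfl hs.le]
    congr! with x
    rw [eq_comm, indicator_eq_self]
    intro x hx
    by_contra! h'
    exact hx (posDensity_of_nonpos g (notMem_Ici.1 h').le)

/-! ### The one-variable integrals -/

lemma integral_sqrt_mul_sqrt {s : ℝ} (hs : 0 < s) :
    ∫ x in (0 : ℝ)..s, √x * √(s - x) = Real.pi / 8 * s ^ 2 := by
  have h := intervalIntegral.integral_comp_mul_add (a := -1) (b := 1)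
    (fun x => √x * √(s - x)) (half_pos hs).ne' (s / 2)
  have e : ∀ t : ℝ, √(s / 2 * t + s / 2) * √(s - (s / 2 * t + s / 2)) = s / 2 * √(1 - t ^ 2) := by
    intro t
    rw [show s / 2 * t + s / 2 = s / 2 * (1 + t) by ring,
      show s - s / 2 * (1 + t) = s / 2 * (1 - t) by ring, Real.sqrt_mul (half_pos hs).le,
      Real.sqrt_mul (half_pos hs).le]
    rw [show √(s / 2) * √(1 + t) * (√(s / 2) * √(1 - t)) = √(s / 2) * √(s / 2) * (√(1 + t) * √(1 - t))
      by ring, Real.mul_self_sqrt (half_pos hs).le]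
    congr 1
    -- The identity is needed for every real `t`; when `1 + t < 0` both sides are 0, since `√`
    -- vanishes on negative numbers.
    rcases le_or_gt 0 (1 + t) with h | h
    · rw [← Real.sqrt_mul h]
      congr 1; ring
    · rw [Real.sqrt_eq_zero_of_nonpos h.le, zero_mul,
        Real.sqrt_eq_zero_of_nonpos (by nlinarith)]
  simp only [e] at h
  rw [intervalIntegral.integral_const_mul, integral_sqrt_one_sub_sq, smul_eq_mul,
    show s / 2 * -1 + s / 2 = 0 by ring, show s / 2 * 1 + s / 2 = s by ring] at h
  rw [inv_mul_eq_div, eq_div_iff (half_pos hs).ne'] at h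
  rw [← h]; ring

lemma integral_sqrt_mul_sq {r : ℝ} (hr : 0 < r) :
    ∫ x in (0 : ℝ)..r, √x * (Real.pi / 8 * (r - x) ^ 2) =
      2 * Real.pi / 105 * (r ^ 3 * √r) := by
  -- The primitive comes from expanding `(r - x) ^ 2`. Differentiability is required only in the
  -- open interval, as `√` is not differentiable at 0.
  have h := intervalIntegral.integral_eq_sub_of_hasDerivAt_of_le hr.le
    (f := fun x => Real.pi / 8 * (√x * (2 / 3 * r ^ 2 * x - 4 / 5 * r * x ^ 2 + 2 / 7 * x ^ 3)))
    (f' := fun x => √x * (Real.pi / 8 * (r - x) ^ 2)) (by fun_prop) ?_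
    (Continuous.intervalIntegrable (by fun_prop) _ _)
  · rw [h]
    simp
    ring
  · intro x hx
    have hs : 0 < √x := Real.sqrt_pos.2 hx.1
    have hss : √x ^ 2 = x := Real.sq_sqrt hx.1.le
    have hd := (Real.hasDerivAt_sqrt hx.1.ne').mul
      ((((hasDerivAt_id x).const_mul (2 / 3 * r ^ 2)).sub
        ((hasDerivAt_pow 2 x).const_mul (4 / 5 * r))).add ((hasDerivAt_pow 3 x).const_mul (2 / 7)))
    refine (hd.const_mul (Real.pi / 8)).congr_deriv ?_
    simp only [id, Pi.add_apply, Pi.sub_apply]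
    field_simp
    rw [hss]
    norm_num
    ring

/-- The integrand is x(1-x)⁴/q with q = √(x(1-x)). The ansatz P(x) q + κ arcsin(2x-1) leads to P'(x)
x(1-x) + P(x)(1-2x)/2 + κ = x(1-x)⁴, and comparing coefficients determines the quartic P and κ =
7/256. -/
lemma hasDerivAt_beta_primitive {x : ℝ} (h0 : 0 < x) (h1 : x < 1) :
    HasDerivAt (fun x => (-1 / 5 * x ^ 4 + 31 / 40 * x ^ 3 - 263 / 240 * x ^ 2 + 121 / 192 * x
      - 7 / 128) * (√x * √(1 - x)) + 7 / 256 * Real.arcsin (2 * x - 1))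
      (√x * ((1 - x) ^ 3 * √(1 - x))) x := by
  set a := √x with ha
  set b := √(1 - x) with hb
  have ha0 : 0 < a := Real.sqrt_pos.2 h0
  have hb0 : 0 < b := Real.sqrt_pos.2 (sub_pos.2 h1)
  have ha2 : a ^ 2 = x := Real.sq_sqrt h0.le
  have hb2 : b ^ 2 = 1 - x := Real.sq_sqrt (sub_pos.2 h1).le
  have d1 : HasDerivAt (fun x => √x * √(1 - x)) ((1 - 2 * x) / (2 * (a * b))) x := by
    have e := (Real.hasDerivAt_sqrt h0.ne').mul
      (((hasDerivAt_id x).const_sub 1).sqrt (sub_pos.2 h1).ne')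
    refine e.congr_deriv ?_
    simp only [id, ← ha, ← hb]
    field_simp
    linear_combination hb2 - ha2
  have d2 : HasDerivAt (fun x => Real.arcsin (2 * x - 1)) (1 / (a * b)) x := by
    have e := (Real.hasDerivAt_arcsin (x := 2 * x - 1) (by linarith) (by linarith)).comp x
      (((hasDerivAt_id x).const_mul 2).sub_const 1)
    refine e.congr_deriv ?_
    have : √(1 - (2 * x - 1) ^ 2) = 2 * (a * b) := by
      rw [show 1 - (2 * x - 1) ^ 2 = (2 * (a * b)) ^ 2 by
        rw [mul_pow, mul_pow, ha2, hb2]; ring, Real.sqrt_sq (by positivity)]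
    rw [this]
    field_simp
  have d3 : HasDerivAt (fun x : ℝ => -1 / 5 * x ^ 4 + 31 / 40 * x ^ 3 - 263 / 240 * x ^ 2 +
      121 / 192 * x - 7 / 128) (-4 / 5 * x ^ 3 + 93 / 40 * x ^ 2 - 263 / 120 * x + 121 / 192) x := by
    have e := (((((hasDerivAt_pow 4 x).const_mul (-1 / 5)).add
      ((hasDerivAt_pow 3 x).const_mul (31 / 40))).sub
      ((hasDerivAt_pow 2 x).const_mul (263 / 240))).add
      ((hasDerivAt_id x).const_mul (121 / 192))).sub_const (7 / 128)
    refine e.congr_deriv ?_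
    norm_num
    ring
  refine ((d3.mul d1).add (d2.const_mul (7 / 256))).congr_deriv ?_
  have e1 : a * ((1 - x) ^ 3 * b) = x * (1 - x) ^ 4 / (a * b) := by
    field_simp
    rw [ha2, hb2]
    ring
  have e2 : (a * b) ^ 2 = x * (1 - x) := by rw [mul_pow, ha2, hb2]
  have e3 : a * b ≠ 0 := by positivity
  rw [← ha, ← hb, e1]
  generalize a * b = q at e2 e3
  rw [eq_div_iff e3]
  calc _ = (-4 / 5 * x ^ 3 + 93 / 40 * x ^ 2 - 263 / 120 * x + 121 / 192) * q ^ 2 +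
        (-1 / 5 * x ^ 4 + 31 / 40 * x ^ 3 - 263 / 240 * x ^ 2 + 121 / 192 * x - 7 / 128) *
          ((1 - 2 * x) / 2) + 7 / 256 := by
        field_simp
    _ = _ := by
        rw [e2]
        ring

lemma integral_beta {c : ℝ} (hc : 0 ≤ c) (hc1 : c ≤ 1) :
    ∫ x in c..1, √x * ((1 - x) ^ 3 * √(1 - x)) = 7 * Real.pi / 512 -
      ((-1 / 5 * c ^ 4 + 31 / 40 * c ^ 3 - 263 / 240 * c ^ 2 + 121 / 192 * c
      - 7 / 128) * (√c * √(1 - c)) + 7 / 256 * Real.arcsin (2 * c - 1)) := by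
  rw [intervalIntegral.integral_eq_sub_of_hasDerivAt_of_le hc1 (by fun_prop)
    (fun x hx => hasDerivAt_beta_primitive (hc.trans_lt hx.1) hx.2)
    (Continuous.intervalIntegrable (by fun_prop) _ _)]
  norm_num
  ring

lemma indicator_Ici_zero_posDensity (g : ℝ → ℝ) :
    (Ici 0).indicator (posDensity g) = posDensity g := by
  rw [indicator_eq_self]
  intro x hx
  by_contra! h'
  exact hx (posDensity_of_nonpos g (notMem_Ici.1 h').le)

/-- A product density on the part of the simplex where the first coordinate is at least `c`. -/
lemma simplexIntegral_posDensity {g I J : ℝ → ℝ} (hg : Continuous g) (hI : Continuous I)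
    (hJ : Continuous J) (hg0 : ∀ x, 0 ≤ x → 0 ≤ g x) (hI0 : ∀ x, 0 ≤ x → 0 ≤ I x)
    (hJ0 : ∀ x, 0 ≤ x → 0 ≤ J x)
    (hgg : ∀ s, 0 < s → ∫ x in (0 : ℝ)..s, g x * g (s - x) = I s)
    (hgI : ∀ s, 0 < s → ∫ x in (0 : ℝ)..s, g x * I (s - x) = J s)
    {c : ℝ} (hc : 0 ≤ c) (hc1 : c ≤ 1) :
    simplexIntegral ((Ici c).indicator (posDensity g)) (posDensity g) (posDensity g)
      (posDensity g) = ENNReal.ofReal (∫ x in c..1, g x * J (1 - x)) := by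
  have hm := measurable_posDensity hg
  rw [simplexIntegral_eq_lintegral hm hm hm]
  simp only [lintegral_posDensity_mul hg hg hg0 hg0 hgg, lintegral_posDensity_mul hg hI hg0 hI0 hgI,
    lintegral_indicator_posDensity hg hJ hg0 hJ0 hc hc1]

/-- The density `g` restricted to `(0, 1 / 2)`. -/
def truncDensity (g : ℝ → ℝ) : ℝ → ℝ≥0∞ :=
  (Iio (1 / 2)).indicator (posDensity g)

/-- `I` and `J` are the twofold and threefold convolutions of `g`; the full simplex corresponds to
the cut at 0, each of the four caps to the cut at `1 / 2`. -/
lemma simplexIntegral_truncDensity {g I J : ℝ → ℝ} (hg : Continuous g) (hI : Continuous I)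
    (hJ : Continuous J) (hg0 : ∀ x, 0 ≤ x → 0 ≤ g x) (hI0 : ∀ x, 0 ≤ x → 0 ≤ I x)
    (hJ0 : ∀ x, 0 ≤ x → 0 ≤ J x)
    (hgg : ∀ s, 0 < s → ∫ x in (0 : ℝ)..s, g x * g (s - x) = I s)
    (hgI : ∀ s, 0 < s → ∫ x in (0 : ℝ)..s, g x * I (s - x) = J s) :
    simplexIntegral (truncDensity g) (truncDensity g) (truncDensity g) (truncDensity g) =
      ENNReal.ofReal ((∫ x in (0 : ℝ)..1, g x * J (1 - x)) -
        4 * ∫ x in (1 / 2 : ℝ)..1, g x * J (1 - x)) := by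
  have h := simplexIntegral_truncate (measurable_posDensity hg)
    (fun y hy => posDensity_of_nonpos g hy)
  have h0 := simplexIntegral_posDensity hg hI hJ hg0 hI0 hJ0 hgg hgI le_rfl zero_le_one
  rw [indicator_Ici_zero_posDensity] at h0
  rw [h0, simplexIntegral_posDensity hg hI hJ hg0 hI0 hJ0 hgg hgI one_half_pos.le
    one_half_lt_one.le] at h
  have hnn : 0 ≤ ∫ x in (1 / 2 : ℝ)..1, g x * J (1 - x) :=
    intervalIntegral.integral_nonneg one_half_lt_one.le fun x hx =>
      mul_nonneg (hg0 x (by linarith [hx.1])) (hJ0 _ (sub_nonneg.2 hx.2))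
  have e4 : (4 : ℝ≥0∞) = ENNReal.ofReal 4 := by simp
  rw [ENNReal.ofReal_sub _ (by positivity), h, ENNReal.ofReal_mul (by norm_num), ← e4]
  exact (ENNReal.add_sub_cancel_right (ENNReal.mul_ne_top (by simp) (by simp))).symm

lemma simplexIntegral_truncDensity_one :
    simplexIntegral (truncDensity 1) (truncDensity 1) (truncDensity 1) (truncDensity 1) =
      ENNReal.ofReal (1 / 12) := by
  rw [simplexIntegral_truncDensity (I := fun s => s) (J := fun s => s ^ 2 / 2) continuous_one
    (by fun_prop) (by fun_prop) (fun _ _ => zero_le_one) (fun _ h => h) (fun _ _ => by positivity)]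
  · congr 1
    have e : ∀ c : ℝ, ∫ x in c..1, (1 : ℝ → ℝ) x * ((1 - x) ^ 2 / 2) = (1 - c) ^ 3 / 6 := by
      intro c
      simp only [Pi.one_apply, one_mul]
      rw [intervalIntegral.integral_comp_sub_left (fun x => x ^ 2 / 2),
        intervalIntegral.integral_div, integral_pow]
      norm_num
      ring
    rw [e, e]
    norm_num
  · intro s _
    simp
  · intro s _
    simp only [Pi.one_apply, one_mul]
    rw [intervalIntegral.integral_comp_sub_left (fun x => x)]
    simp

lemma simplexIntegral_truncDensity_sqrt :
    simplexIntegral (truncDensity Real.sqrt) (truncDensity Real.sqrt) (truncDensity Real.sqrt)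
      (truncDensity Real.sqrt) =
      ENNReal.ofReal ((17 * Real.pi / 525 - Real.pi ^ 2 / 160) / 12) := by
  have hpi := Real.pi_pos
  rw [simplexIntegral_truncDensity (I := fun s => Real.pi / 8 * s ^ 2)
    (J := fun s => 2 * Real.pi / 105 * (s ^ 3 * √s)) Real.continuous_sqrt
    (by fun_prop) (by fun_prop) (fun _ _ => Real.sqrt_nonneg _) (fun _ _ => by positivity)
    (fun _ _ => by positivity) (fun s hs => integral_sqrt_mul_sqrt hs)
    (fun s hs => integral_sqrt_mul_sq hs)]
  congr 1
  simp only [mul_left_comm _ (2 * Real.pi / 105)]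
  rw [intervalIntegral.integral_const_mul, intervalIntegral.integral_const_mul,
    integral_beta le_rfl zero_le_one, integral_beta one_half_pos.le one_half_lt_one.le]
  have h1 : √(1 / 2) * √(1 - 1 / 2) = 1 / 2 := by
    rw [show (1 : ℝ) - 1 / 2 = 1 / 2 by norm_num]
    exact Real.mul_self_sqrt one_half_pos.le
  have h2 : Real.arcsin (2 * 0 - 1) = -(Real.pi / 2) := by norm_num
  have h3 : Real.arcsin (2 * (1 / 2) - 1) = 0 := by norm_num
  rw [h1, h2, h3, Real.sqrt_zero]
  ring

/-! ### From uniform break points to the simplex -/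

/-- The lengths of the pieces cut by break points given in increasing order. -/
def gaps (v : Fin 3 → ℝ) : Fin 4 → ℝ := ![v 0, v 1 - v 0, v 2 - v 1, 1 - v 2]

lemma pieces_eq_gaps (u : Fin 3 → ℝ) : pieces u = gaps (u ∘ Tuple.sort u) := rfl

lemma sum_pieces (u : Fin 3 → ℝ) : ∑ i, pieces u i = 1 := by
  rw [pieces_eq_gaps, Fin.sum_univ_four]
  simp [gaps]

/-- A product density evaluated at the distances of the gaps from `1 / 2`. -/
def gapDensity (φ : ℝ → ℝ≥0∞) (v : Fin 3 → ℝ) : ℝ≥0∞ := ∏ i, φ (1 / 2 - gaps v i)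

section gapDensity

variable {φ : ℝ → ℝ≥0∞}

lemma measurable_gapDensity (hφ : Measurable φ) : Measurable (gapDensity φ) := by
  unfold gapDensity
  simp only [Fin.prod_univ_four]
  simp only [gaps, Matrix.cons_val]
  fun_prop

lemma gaps_pos_of_gapDensity_ne_zero (h1 : ∀ y, 1 / 2 ≤ y → φ y = 0) {v : Fin 3 → ℝ}
    (h : gapDensity φ v ≠ 0) (i : Fin 4) : 0 < gaps v i := by
  by_contra! hi
  exact h (Finset.prod_eq_zero (Finset.mem_univ i) (h1 _ (by linarith)))

lemma strictMono_of_gaps_pos {v : Fin 3 → ℝ} (h : ∀ i, 0 < gaps v i) : StrictMono v := by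
  have h1 : 0 < v 1 - v 0 := h 1
  have h2 : 0 < v 2 - v 1 := h 2
  refine Fin.strictMono_iff_lt_succ.2 fun i => ?_
  fin_cases i
  · exact sub_pos.1 h1
  · exact sub_pos.1 h2

/-- By `h1` the density vanishes unless all gaps are positive, which happens for at most the sorting
permutation. The sum removes the sorting, so measurability and integrals follow term by term. -/
lemma gapDensity_sort (h1 : ∀ y, 1 / 2 ≤ y → φ y = 0) (u : Fin 3 → ℝ) :
    gapDensity φ (u ∘ Tuple.sort u) = ∑ σ : Equiv.Perm (Fin 3), gapDensity φ (u ∘ σ) := by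
  rw [eq_comm]
  refine Finset.sum_eq_single (Tuple.sort u) (fun σ _ hσ => ?_) fun h =>
    absurd (Finset.mem_univ _) h
  by_contra hne
  have hm := strictMono_of_gaps_pos (gaps_pos_of_gapDensity_ne_zero h1 hne)
  exact hσ (Tuple.eq_sort_iff.2 ⟨hm.monotone, fun i j hij he => absurd he (hm hij).ne⟩)

lemma measurable_gapDensity_sort (hφ : Measurable φ) (h1 : ∀ y, 1 / 2 ≤ y → φ y = 0) :
    Measurable fun u : Fin 3 → ℝ => gapDensity φ (u ∘ Tuple.sort u) := by
  simp only [gapDensity_sort h1]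
  refine Finset.measurable_sum _ fun σ _ => (measurable_gapDensity hφ).comp ?_
  exact measurable_pi_lambda _ fun i => measurable_pi_apply _

lemma lintegral_comp_perm {n : ℕ} (f : (Fin n → ℝ) → ℝ≥0∞) (σ : Equiv.Perm (Fin n)) :
    ∫⁻ u : Fin n → ℝ, f (u ∘ σ) = ∫⁻ u, f u := by
  have h := volume_measurePreserving_piCongrLeft (fun _ : Fin n => ℝ) σ.symm
  rw [← h.lintegral_comp_emb (MeasurableEquiv.measurableEmbedding _) f]
  refine lintegral_congr fun u => congrArg f (funext fun i => ?_)
  have := MeasurableEquiv.piCongrLeft_apply_apply (β := fun _ : Fin n => ℝ) (e := σ.symm) u (σ i)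
  simpa using this.symm

lemma lintegral_fin_three {f : (Fin 3 → ℝ) → ℝ≥0∞} (hf : Measurable f) :
    ∫⁻ v, f v = ∫⁻ x, ∫⁻ y, ∫⁻ z, f ![x, y, z] := by
  have h := (volume_preserving_piFinSuccAbove (fun _ : Fin 3 => ℝ) 0).symm
  rw [← h.lintegral_comp_emb (MeasurableEquiv.measurableEmbedding _), Measure.volume_eq_prod,
    lintegral_prod (fun q : ℝ × (Fin 2 → ℝ) => f ((MeasurableEquiv.piFinSuccAbove
      (fun _ : Fin 3 => ℝ) 0).symm q)) (hf.comp h.measurable).aemeasurable]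
  refine lintegral_congr fun x => ?_
  have h2 := (volume_preserving_finTwoArrow ℝ).symm
  rw [← h2.lintegral_comp_emb (MeasurableEquiv.measurableEmbedding _), Measure.volume_eq_prod,
    lintegral_prod]
  · refine lintegral_congr fun y => lintegral_congr fun z => congrArg f ?_
    ext i
    fin_cases i <;> rfl
  · exact (hf.comp (h.measurable.comp (measurable_prodMk_left.comp h2.measurable))).aemeasurable

lemma lintegral_gapDensity (hφ : Measurable φ) :
    ∫⁻ v, gapDensity φ v = simplexIntegral φ φ φ φ := by
  rw [lintegral_fin_three (measurable_gapDensity hφ), simplexIntegral]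
  simp only [gapDensity, Fin.prod_univ_four]
  simp only [gaps, Matrix.cons_val]
  -- Each reflection replaces a break point by the coordinate `1 / 2 - gap`. The gaps sum to 1,
  -- hence so do the four new coordinates, and the last one is `1 - x - y - z`.
  rw [← lintegral_sub_left_eq_self _ (1 / 2)]
  refine lintegral_congr fun x => ?_
  rw [← lintegral_sub_left_eq_self _ (1 / 2 - x + 1 / 2)]
  refine lintegral_congr fun y => ?_
  rw [← lintegral_sub_left_eq_self _ (1 / 2 - x + 1 / 2 - y + 1 / 2)]
  refine lintegral_congr fun z => ?_
  congr! 2 <;> ring_nf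

lemma lintegral_gapDensity_sort (hφ : Measurable φ) (h1 : ∀ y, 1 / 2 ≤ y → φ y = 0) :
    ∫⁻ u : Fin 3 → ℝ, gapDensity φ (u ∘ Tuple.sort u) = 6 * simplexIntegral φ φ φ φ := by
  simp only [gapDensity_sort h1]
  rw [lintegral_finsetSum]
  · simp only [lintegral_comp_perm, lintegral_gapDensity hφ, Finset.sum_const, Finset.card_univ,
      Fintype.card_perm, Fintype.card_fin]
    simp [Nat.factorial]
  · exact fun σ _ => (measurable_gapDensity hφ).comp
      (measurable_pi_lambda _ fun i => measurable_pi_apply _)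

/-- The density is supported in the cube, so integrating against the uniform law is the same as
integrating over the whole space. -/
lemma mem_cube_of_gapDensity_ne_zero (h1 : ∀ y, 1 / 2 ≤ y → φ y = 0) {u : Fin 3 → ℝ}
    (h : gapDensity φ (u ∘ Tuple.sort u) ≠ 0) : u ∈ univ.pi fun _ => Icc (0 : ℝ) 1 := by
  have hg := gaps_pos_of_gapDensity_ne_zero h1 h
  have hm := (strictMono_of_gaps_pos hg).monotone
  have h0 : 0 < (u ∘ Tuple.sort u) 0 := hg 0
  have h3 : 0 < 1 - (u ∘ Tuple.sort u) 2 := hg 3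
  have key : ∀ j, (u ∘ Tuple.sort u) j ∈ Icc (0 : ℝ) 1 := fun j =>
    ⟨h0.le.trans (hm (Fin.zero_le j)), (hm (Fin.le_last j)).trans (sub_pos.1 h3).le⟩
  intro i _
  simpa using key ((Tuple.sort u).symm i)

variable {Ω : Type*} [MeasurableSpace Ω] {P : Measure Ω} [IsProbabilityMeasure P]
  {U : Fin 3 → Ω → ℝ}

lemma map_eq_restrict_cube (hmeas : ∀ i, Measurable (U i))
    (hunif : ∀ i, pdf.IsUniform (U i) (Icc (0 : ℝ) 1) P volume) (hindep : iIndepFun U P) :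
    P.map (fun ω i => U i ω) = volume.restrict (univ.pi fun _ => Icc (0 : ℝ) 1) := by
  rw [(iIndepFun_iff_map_fun_eq_pi_map fun i => (hmeas i).aemeasurable).1 hindep, volume_pi,
    Measure.restrict_pi_pi]
  congr 1
  funext i
  rw [hunif i, ProbabilityTheory.cond]
  simp

lemma lintegral_gapDensity_uniform (hmeas : ∀ i, Measurable (U i))
    (hunif : ∀ i, pdf.IsUniform (U i) (Icc (0 : ℝ) 1) P volume) (hindep : iIndepFun U P)
    (hφ : Measurable φ) (h1 : ∀ y, 1 / 2 ≤ y → φ y = 0) :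
    ∫⁻ ω, gapDensity φ ((fun i => U i ω) ∘ Tuple.sort fun i => U i ω) ∂P =
      6 * simplexIntegral φ φ φ φ := by
  rw [← lintegral_gapDensity_sort hφ h1,
    ← lintegral_map (f := fun u : Fin 3 → ℝ => gapDensity φ (u ∘ Tuple.sort u))
      (measurable_gapDensity_sort hφ h1) (measurable_pi_lambda _ hmeas),
    map_eq_restrict_cube hmeas hunif hindep]
  exact setLIntegral_eq_of_support_subset fun u hu => mem_cube_of_gapDensity_ne_zero h1 hu

end gapDensity

/-! ### The event, the maximal area and the expectation -/

lemma measurable_truncDensity {g : ℝ → ℝ} (hg : Continuous g) : Measurable (truncDensity g) :=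
  (measurable_posDensity hg).indicator measurableSet_Iio

lemma truncDensity_of_half_le (g : ℝ → ℝ) (y : ℝ) (hy : 1 / 2 ≤ y) : truncDensity g y = 0 :=
  indicator_of_notMem (notMem_Iio.2 hy) _

lemma truncDensity_of_nonpos (g : ℝ → ℝ) {y : ℝ} (hy : y ≤ 0) : truncDensity g y = 0 := by
  rw [truncDensity, indicator_of_mem (mem_Iio.2 (by linarith)), posDensity_of_nonpos g hy]

lemma truncDensity_of_mem (g : ℝ → ℝ) {y : ℝ} (hy : 0 < y) (hy' : y < 1 / 2) :
    truncDensity g y = ENNReal.ofReal (g y) := by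
  rw [truncDensity, indicator_of_mem (mem_Iio.2 hy'), posDensity_of_pos g hy]

lemma formQuadrilateral_iff {u : Fin 3 → ℝ} :
    FormQuadrilateral u ↔ ∀ i, 0 < pieces u i ∧ pieces u i < 1 / 2 := by
  rw [FormQuadrilateral, exists_isFormedFrom_iff, QuadIneq, sum_pieces]
  refine forall_congr' fun i => and_congr_right fun _ => ?_
  constructor <;> intro h <;> linarith

lemma gapDensity_truncDensity_of_formQuadrilateral {g : ℝ → ℝ} (hg0 : ∀ x, 0 ≤ x → 0 ≤ g x)
    {u : Fin 3 → ℝ} (h : FormQuadrilateral u) :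
    gapDensity (truncDensity g) (u ∘ Tuple.sort u) =
      ENNReal.ofReal (∏ i, g (1 / 2 - pieces u i)) := by
  rw [formQuadrilateral_iff] at h
  rw [ENNReal.ofReal_prod_of_nonneg fun i _ => hg0 _ (by linarith [(h i).2])]
  refine Finset.prod_congr rfl fun i _ => ?_
  rw [← pieces_eq_gaps]
  exact truncDensity_of_mem g (by linarith [(h i).2]) (by linarith [(h i).1])

lemma gapDensity_truncDensity_of_not_formQuadrilateral (g : ℝ → ℝ) {u : Fin 3 → ℝ}
    (h : ¬FormQuadrilateral u) : gapDensity (truncDensity g) (u ∘ Tuple.sort u) = 0 := by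
  rw [formQuadrilateral_iff] at h
  push Not at h
  obtain ⟨i, hi⟩ := h
  refine Finset.prod_eq_zero (Finset.mem_univ i) ?_
  rw [← pieces_eq_gaps]
  rcases le_or_gt (pieces u i) 0 with h0 | h0
  · exact truncDensity_of_half_le g _ (by linarith)
  · exact truncDensity_of_nonpos g (by linarith [hi h0])

/-- The half perimeter is `1 / 2`, and on the event all factors are nonnegative, so the root
distributes over the product. -/
lemma FormQuadrilateral.maxArea_eq {u : Fin 3 → ℝ} (h : FormQuadrilateral u) :
    maxArea (pieces u) = ∏ i, √(1 / 2 - pieces u i) := by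
  rw [(exists_isFormedFrom_iff.1 h).maxArea_eq, brahmagupta, sum_pieces, Real.sqrt_prod]
  intro i _
  linarith [(formQuadrilateral_iff.1 h i).2]

end BrokenStick

end

theorem mainTheorem4 {Ω : Type*} [MeasurableSpace Ω] (P : Measure Ω) [IsProbabilityMeasure P]
    (U : Fin 3 → Ω → ℝ) (hmeas : ∀ i, Measurable (U i))
    (hunif : ∀ i, pdf.IsUniform (U i) (Set.Icc (0 : ℝ) 1) P volume)
    (hindep : iIndepFun U P) :
    P {ω | BrokenStick.FormQuadrilateral (fun i => U i ω)} ≠ 0 ∧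
    (∀ ω, BrokenStick.FormQuadrilateral (fun i => U i ω) →
      (∃ Q : Polygon BrokenStick.Plane 4,
        BrokenStick.IsMaximalFrom (BrokenStick.pieces fun i => U i ω) Q) ∧
      ∀ Q : Polygon BrokenStick.Plane 4,
        BrokenStick.IsMaximalFrom (BrokenStick.pieces fun i => U i ω) Q →
          BrokenStick.IsCyclic Q) ∧
    Integrable (fun ω => BrokenStick.maxArea (BrokenStick.pieces fun i => U i ω))
      P[|{ω | BrokenStick.FormQuadrilateral (fun i => U i ω)}] ∧
    ∫ ω, BrokenStick.maxArea (BrokenStick.pieces fun i => U i ω)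
        ∂P[|{ω | BrokenStick.FormQuadrilateral (fun i => U i ω)}] =
      17 * Real.pi / 525 - Real.pi ^ 2 / 160 := by
  open BrokenStick in
  set F : Set Ω := {ω | FormQuadrilateral (fun i => U i ω)} with hF
  -- `D 1` is the indicator of `F`, and `D Real.sqrt` is the maximal area on `F` and 0 elsewhere.
  -- Both are measurable, unlike anything visible from the definitions of `F` and `maxArea` through
  -- polygons.
  set D : (ℝ → ℝ) → Ω → ENNReal := fun g ω =>
    gapDensity (truncDensity g) ((fun i => U i ω) ∘ Tuple.sort fun i => U i ω) with hD
  have hDm : ∀ {g : ℝ → ℝ}, Continuous g → Measurable (D g) := fun hg =>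
    (measurable_gapDensity_sort (measurable_truncDensity hg) (truncDensity_of_half_le _)).comp
      (measurable_pi_lambda _ hmeas)
  have hDint : ∀ {g : ℝ → ℝ}, Continuous g → ∫⁻ ω, D g ω ∂P = 6 * simplexIntegral
      (truncDensity g) (truncDensity g) (truncDensity g) (truncDensity g) := fun hg =>
    lintegral_gapDensity_uniform hmeas hunif hindep (measurable_truncDensity hg)
      (truncDensity_of_half_le _)
  have hone : ∀ ω ∈ F, D 1 ω = 1 := fun ω hω => by
    rw [hD]
    simp [gapDensity_truncDensity_of_formQuadrilateral (g := 1) (fun _ _ => zero_le_one) hω]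
  have hzero : ∀ g, ∀ ω ∉ F, D g ω = 0 := fun g ω hω =>
    gapDensity_truncDensity_of_not_formQuadrilateral g hω
  have hFm : MeasurableSet F := by
    have : F = D 1 ⁻¹' {1} := by
      ext ω
      refine ⟨hone ω, fun h => ?_⟩
      by_contra hω
      rw [Set.mem_preimage, hzero 1 ω hω] at h
      exact zero_ne_one h
    rw [this]
    exact hDm continuous_one (measurableSet_singleton 1)
  have hPF : P F = ENNReal.ofReal (1 / 2) := by
    have e : D 1 = F.indicator 1 := by
      ext ω
      by_cases hω : ω ∈ F
      · rw [hone ω hω, Set.indicator_of_mem hω, Pi.one_apply]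
      · rw [hzero 1 ω hω, Set.indicator_of_notMem hω]
    have h := hDint continuous_one
    rw [e, lintegral_indicator_one hFm, simplexIntegral_truncDensity_one] at h
    rw [h, show (6 : ENNReal) = ENNReal.ofReal 6 by simp, ← ENNReal.ofReal_mul (by norm_num)]
    norm_num
  have hsq := hDint Real.continuous_sqrt
  rw [simplexIntegral_truncDensity_sqrt] at hsq
  have hsqfin : ∫⁻ ω, D Real.sqrt ω ∂P ≠ ⊤ := by
    rw [hsq]
    exact ENNReal.mul_ne_top (by simp) (by simp)
  have hDi : Integrable (fun ω => (D Real.sqrt ω).toReal) P :=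
    integrable_toReal_of_lintegral_ne_top (hDm Real.continuous_sqrt).aemeasurable hsqfin
  have hX : ∀ ω ∈ F, (D Real.sqrt ω).toReal = maxArea (pieces fun i => U i ω) := fun ω hω => by
    rw [hD]
    simp only
    rw [gapDensity_truncDensity_of_formQuadrilateral (fun x _ => Real.sqrt_nonneg x) hω,
      ENNReal.toReal_ofReal (Finset.prod_nonneg fun i _ => Real.sqrt_nonneg _),
      FormQuadrilateral.maxArea_eq hω]
  have hae : (fun ω => (D Real.sqrt ω).toReal) =ᵐ[P.restrict F]
      fun ω => maxArea (pieces fun i => U i ω) := (ae_restrict_mem hFm).mono hX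
  have hPF0 : P F ≠ 0 := by rw [hPF]; simp
  refine ⟨hPF0, fun ω hω => ⟨(exists_isFormedFrom_iff.1 hω).exists_isMaximalFrom,
    fun Q hQ => hQ.isCyclic⟩, ?_, ?_⟩
  · rw [ProbabilityTheory.cond]
    exact (hDi.restrict.congr hae).smul_measure (ENNReal.inv_ne_top.2 hPF0)
  -- Since `D Real.sqrt` vanishes off `F`, the integral over `F` is the full integral, 6 times the
  -- simplex value; dividing by `P F = 1 / 2` cancels the factor `1 / 12`.
  · rw [ProbabilityTheory.cond, integral_smul_measure, ← integral_congr_ae hae,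
      setIntegral_eq_integral_of_forall_compl_eq_zero fun ω hω => by
        rw [hzero _ ω hω, ENNReal.toReal_zero],
      integral_toReal (hDm Real.continuous_sqrt).aemeasurable
        (ae_lt_top (hDm Real.continuous_sqrt) hsqfin), hsq, hPF]
    -- `ENNReal.ofReal` truncates negative numbers to 0, so the sign has to be checked; `π < 3.15`
    -- suffices.
    have hnn : 0 ≤ (17 * Real.pi / 525 - Real.pi ^ 2 / 160) / 12 := by
      have := Real.pi_pos
      have := Real.pi_lt_d2
      nlinarith
    rw [ENNReal.toReal_mul, ENNReal.toReal_ofReal hnn, ENNReal.toReal_inv,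
      ENNReal.toReal_ofReal one_half_pos.le]
    norm_num
    ring
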